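/- Let $\widehat{\mathbb C}=\mathbb C\cup\{\infty\}$ be the Riemann sphere, with the conventions $\infty\cdot 0=0\cdot\infty=1$ and $\infty\cdot z=z\cdot\infty=\infty$ for $z\neq 0$, and let $$\Omega=\{(z,w)\in\widehat{\mathbb C}^2 : z\cdot w\neq 1\},$$ an open complex submanifold of $\widehat{\mathbb C}^2$. Let $\Delta_{zw}F(z,w)=4(1-zw)^2\,\partial_z\partial_wF(z,w)$ for holomorphic $F:\Omega\to\mathbb C$ (read in the coordinates $1/z$, $1/w$ at the points with an infinite entry), and for $\lambda\in\mathbb C$ let $X_\lambda(\Omega)$ be the space of holomorphic $F:\Omega\to\mathbb C$ with $\Delta_{zw}F=\lambda F$ on $\Omega$. For $m\in\mathbb N_0$ and $n\in\mathbb Z$ let $P_n^{-m}:\Omega\to\mathbb C$ be the holomorphic function given at finite points by $$P_n^{-m}(z,w)=(-1)^n\binom{m}{|n|}(1-zw)^{-m}\,{}_2F_1(-m,|n|-m;|n|+1;zw)\cdot\begin{cases}w^n & (n\ge 0)\\ z^{|n|} & (n\le 0),\end{cases}$$ where ${}_2F_1$ is the (here terminating) hypergeometric series. For $|n|\le m$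 put $$Y_n^{-m}=\sqrt{2m+1}\,\binom{m}{|n|}^{-1/2}\binom{-m-1}{|n|}^{1/2}P_n^{-m}$$ (principal square roots), and define the complex zonal harmonic of degree $m$ as the function $Z_m:\Omega\times\Omega\to\mathbb C$, $$Z_m\big((z,w),(u,v)\big)=\sum_{j=-m}^{m}Y_j^{-m}(z,w)\,Y_{-j}^{-m}(u,v).$$ Then for every $m\in\mathbb N_0$: (a) (Symmetry) $Z_m\big((z,w),(u,v)\big)=Z_m\big((u,v),(z,w)\big)$ for all $(z,w),(u,v)\in\Omega$. (b) (Definiteness) $Z_m\big((z,w),(z,w)\big)=2m+1$ for all $(z,w)\in\Omega$. (c) (Reproducing property) For all $(z,w)\in\Omega$ and all $f\in X_{4m(m+1)}(\Omega)$, $$\frac{1}{\pi}\int_{\mathbb C} f(\eta,-\overline{\eta})\,Z_m\big((z,w),(\eta,-\overline{\eta})\big)\,\frac{dA(\eta)}{(1+|\eta|^2)^2}=f(z,w),$$ where $dA$ is the Lebesgue measure on $\mathbb C$; the integrand is integrable. Thus the integral is taken over the rotated diagonal $\{(\eta,-\overline\eta):\eta\in\widehat{\mathbb C}\}$ (up to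 the single point $\eta=\infty$) with respect to the normalized spherical area measure, of total mass $1$. -/

import Mathlib

open scoped OnePoint

namespace ComplexZonal

noncomputable section

/-- Multiplication on the Riemann sphere `OnePoint ℂ`, with the convention `∞ * 0 = 0 * ∞ = 1` and
`∞ * z = z * ∞ = ∞` for `z ≠ 0`. -/
def sphereMul : OnePoint ℂ → OnePoint ℂ → OnePoint ℂ
  | OnePoint.some z, OnePoint.some w => ((z * w : ℂ) : OnePoint ℂ)
  | OnePoint.some z, OnePoint.infty => if z = 0 then ((1 : ℂ) : OnePoint ℂ) else ∞
  | OnePoint.infty, OnePoint.some w => if w = 0 then ((1 : ℂ) : OnePoint ℂ) else ∞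
  | OnePoint.infty, OnePoint.infty => ∞

/-- The domain `Ω = {(z, w) : z * w ≠ 1}` in the product of two Riemann spheres. -/
def Omega : Set (OnePoint ℂ × OnePoint ℂ) :=
  {p | sphereMul p.1 p.2 ≠ ((1 : ℂ) : OnePoint ℂ)}

/-- The two standard holomorphic parametrizations of the Riemann sphere: `x ↦ x` (for `false`) and
`x ↦ 1 / x`, `0 ↦ ∞` (for `true`). -/
def chart : Bool → ℂ → OnePoint ℂ
  | false, x => (x : OnePoint ℂ)
  | true, x => if x = 0 then ∞ else ((x⁻¹ : ℂ) : OnePoint ℂ)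

open Classical in
/-- A function on `Ω` read in one of the four product charts (extended by zero outside the part of
`ℂ × ℂ` that parametrizes points of `Ω`, which is open). -/
def pull (F : Omega → ℂ) (i j : Bool) (x y : ℂ) : ℂ :=
  if h : (chart i x, chart j y) ∈ Omega then F ⟨(chart i x, chart j y), h⟩ else 0

/-- Holomorphic functions on the complex manifold `Ω`: holomorphic in each of the four charts. -/
def IsHolomorphic (F : Omega → ℂ) : Prop :=
  ∀ i j : Bool, DifferentiableOn ℂ (fun q : ℂ × ℂ => pull F i j q.1 q.2)
    {q : ℂ × ℂ | (chart i q.1, chart j q.2) ∈ Omega}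

/-- The mixed complex derivative `∂_x ∂_y` of `F` in a chart. -/
def mixedDeriv (F : Omega → ℂ) (i j : Bool) (x y : ℂ) : ℂ :=
  deriv (fun s => deriv (fun t => pull F i j s t) y) x

/-- The canonical Laplacian `Δ F (z, w) = 4 (1 - z w) ^ 2 ∂_z ∂_w F (z, w)` on `Ω`.
In the coordinates `x = 1 / z`, `y = 1 / w` it reads `4 (1 - x y) ^ 2 ∂_x ∂_y`; in the coordinates
`x = 1 / z`, `w` it reads `- 4 (x - w) ^ 2 ∂_x ∂_w`, and in the coordinates `z`, `y = 1 / w` it reads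
`- 4 (y - z) ^ 2 ∂_z ∂_y`. These expressions are used at the points with an infinite entry, where
`x = 0` or `y = 0`. -/
def laplacian (F : Omega → ℂ) (p : Omega) : ℂ :=
  match p.1 with
  | (OnePoint.some z, OnePoint.some w) => 4 * (1 - z * w) ^ 2 * mixedDeriv F false false z w
  | (OnePoint.infty, OnePoint.some w) => - 4 * (0 - w) ^ 2 * mixedDeriv F true false 0 w
  | (OnePoint.some z, OnePoint.infty) => - 4 * (0 - z) ^ 2 * mixedDeriv F false true z 0
  | (OnePoint.infty, OnePoint.infty) => 4 * (1 - 0 * 0) ^ 2 * mixedDeriv F true true 0 0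

/-- The eigenspace `X_μ(Ω)` of holomorphic functions with `Δ F = μ F`. -/
def eigenspace (μ : ℂ) : Set (Omega → ℂ) :=
  {F | IsHolomorphic F ∧ ∀ p : Omega, laplacian F p = μ * F p}

/-- The Poisson Fourier mode `P_n^{-m}` on `Ω`: at finite points
`(-1)^n binom(m, |n|) (1 - z w)^{-m} ₂F₁(-m, |n| - m; |n| + 1; z w)` times `w^n` for `n ≥ 0` and times
`z^{|n|}` for `n ≤ 0`. At the points with an infinite entry the value is that of the holomorphic
extension (see `isHolomorphic_poissonMode`). -/
def poissonMode (m : ℕ) (n : ℤ) (p : Omega) : ℂ :=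
  match p.1 with
  | (OnePoint.some z, OnePoint.some w) =>
      (-1) ^ n.natAbs * (m.choose n.natAbs : ℂ) * ((1 - z * w) ^ m)⁻¹ *
        ordinaryHypergeometric (-(m : ℂ)) ((n.natAbs : ℂ) - m) ((n.natAbs : ℂ) + 1) (z * w) *
        (if 0 ≤ n then w ^ n.natAbs else z ^ n.natAbs)
  | (OnePoint.infty, OnePoint.some w) =>
      if n ≤ 0 then (-1) ^ (m + n.natAbs) * (m.choose n.natAbs : ℂ) * (w ^ n.natAbs)⁻¹ else 0
  | (OnePoint.some z, OnePoint.infty) =>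
      if 0 ≤ n then (-1) ^ (m + n.natAbs) * (m.choose n.natAbs : ℂ) * (z ^ n.natAbs)⁻¹ else 0
  | (OnePoint.infty, OnePoint.infty) => if n = 0 then (-1) ^ m else 0

theorem choose_mul_hypergeometric {m N : ℕ} (hN : N ≤ m) (x : ℂ) :
    (m.choose N : ℂ) * ordinaryHypergeometric (-(m : ℂ)) ((N : ℂ) - m) ((N : ℂ) + 1) x =
      ∑ k ∈ Finset.range (m - N + 1), (m.choose (k + N) : ℂ) * (m.choose k : ℂ) * x ^ k := by
  have hNm : (N : ℂ) - m = -((m - N : ℕ) : ℂ) := by push_cast [hN]; ring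
  rw [ordinaryHypergeometric_eq_tsum, hNm]
  simp only [ascPochhammer_eval_neg_eq_descPochhammer, descPochhammer_eval_eq_descFactorial,
    smul_eq_mul]
  rw [tsum_eq_sum (s := Finset.range (m - N + 1)), Finset.mul_sum]
  · refine Finset.sum_congr rfl fun k hk => ?_
    have hk' : k ≤ m - N := by simpa [Nat.lt_succ_iff] using hk
    have h1 : (ascPochhammer ℂ k).eval ((N : ℂ) + 1) = ((N + 1).ascFactorial k : ℂ) := by
      rw [← ascPochhammer_nat_eq_ascFactorial, ascPochhammer_eval_cast]
      norm_num
    rw [h1]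
    have h2 : ((N + 1).ascFactorial k : ℂ) ≠ 0 := by
      exact_mod_cast (Nat.ascFactorial_pos N k).ne'
    have h3 : ((k.factorial : ℕ) : ℂ) ≠ 0 := by exact_mod_cast k.factorial_ne_zero
    have key : m.choose N * (m - N).descFactorial k * m.descFactorial k =
        m.choose (k + N) * m.choose k * (k.factorial * (N + 1).ascFactorial k) := by
      have h5 := Nat.choose_mul (n := m) (k := k + N) (s := N) (by omega)
      rw [Nat.add_sub_cancel] at h5
      rw [Nat.descFactorial_eq_factorial_mul_choose, Nat.descFactorial_eq_factorial_mul_choose,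
        Nat.ascFactorial_eq_factorial_mul_choose, Nat.add_comm N k, Nat.choose_symm_add]
      linear_combination k.factorial * k.factorial * m.choose k * h5.symm
    have key' : (m.choose N : ℂ) * (m - N).descFactorial k * m.descFactorial k =
        m.choose (k + N) * m.choose k * (k.factorial * (N + 1).ascFactorial k) := by
      exact_mod_cast key
    have h4 : ((-1 : ℂ) ^ k) * (-1) ^ k = 1 := by rw [← mul_pow]; simp
    field_simp
    linear_combination x ^ k * key' + (x ^ k * (m.choose N : ℂ) * (m - N).descFactorial k *
      m.descFactorial k) * h4
  · intro k hk
    have hk' : m - N < k := by simpa [Nat.lt_succ_iff] using hk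
    rw [Nat.descFactorial_of_lt hk']
    simp

/-- The Poisson Fourier mode in homogeneous coordinates `z = a / b`, `w = c / d`. -/
def homMode (m : ℕ) (n : ℤ) (a b c d : ℂ) : ℂ :=
  (-1) ^ n.natAbs * (∑ k ∈ Finset.range (m - n.natAbs + 1),
    (m.choose (k + n.natAbs) : ℂ) * (m.choose k : ℂ) * (a * c) ^ k *
      (b * d) ^ (m - n.natAbs - k)) *
    (if 0 ≤ n then b * c else a * d) ^ n.natAbs * ((b * d - a * c) ^ m)⁻¹

theorem homMode_smul (m : ℕ) (n : ℤ) (s t a b c d : ℂ) (hs : s ≠ 0) (ht : t ≠ 0) :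
    homMode m n (s * a) (s * b) (t * c) (t * d) = homMode m n a b c d := by
  unfold homMode
  by_cases hN : n.natAbs ≤ m
  · have e1 : ∀ k ∈ Finset.range (m - n.natAbs + 1),
        (m.choose (k + n.natAbs) : ℂ) * (m.choose k : ℂ) * (s * a * (t * c)) ^ k *
          (s * b * (t * d)) ^ (m - n.natAbs - k) = (s * t) ^ (m - n.natAbs) *
        ((m.choose (k + n.natAbs) : ℂ) * (m.choose k : ℂ) * (a * c) ^ k *
          (b * d) ^ (m - n.natAbs - k)) := by
      intro k hk
      have hk' : k ≤ m - n.natAbs := by simpa [Nat.lt_succ_iff] using hk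
      have : (s * t) ^ (m - n.natAbs) = (s * t) ^ k * (s * t) ^ (m - n.natAbs - k) := by
        rw [← pow_add]; congr 1; omega
      rw [this, show s * a * (t * c) = (s * t) * (a * c) by ring,
        show s * b * (t * d) = (s * t) * (b * d) by ring, mul_pow, mul_pow (s * t) (b * d)]
      ring
    rw [Finset.sum_congr rfl e1, ← Finset.mul_sum]
    have e2 : (if 0 ≤ n then s * b * (t * c) else s * a * (t * d)) =
        (s * t) * (if 0 ≤ n then b * c else a * d) := by split_ifs <;> ring
    have e3 : s * b * (t * d) - s * a * (t * c) = (s * t) * (b * d - a * c) := by ring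
    rw [e2, e3, mul_pow (s * t) (if 0 ≤ n then _ else _), mul_pow (s * t) (b * d - a * c), mul_inv]
    have e4 : (s * t) ^ m = (s * t) ^ (m - n.natAbs) * (s * t) ^ n.natAbs := by
      rw [← pow_add]; congr 1; omega
    have e5 : (s * t) ^ (m - n.natAbs) ≠ 0 := pow_ne_zero _ (mul_ne_zero hs ht)
    have e6 : (s * t) ^ n.natAbs ≠ 0 := pow_ne_zero _ (mul_ne_zero hs ht)
    rw [e4]
    field_simp
  · have : ∀ k, m.choose (k + n.natAbs) = 0 := fun k => Nat.choose_eq_zero_of_lt (by omega)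
    simp [this]

/-- Membership of finite points in `Ω`. -/
theorem coe_mem_Omega {z w : ℂ} :
    ((z : OnePoint ℂ), (w : OnePoint ℂ)) ∈ Omega ↔ z * w ≠ 1 := by
  simp [Omega, sphereMul]

/-- The mode at finite points in homogeneous coordinates. -/
theorem poissonMode_coe (m : ℕ) (n : ℤ) (z w : ℂ)
    (h : ((z : OnePoint ℂ), (w : OnePoint ℂ)) ∈ Omega) :
    poissonMode m n ⟨_, h⟩ = homMode m n z 1 w 1 := by
  simp only [poissonMode, homMode]
  by_cases hN : n.natAbs ≤ m
  · rw [show ∀ A B C D E : ℂ, A * B * C * D * E = A * (B * D) * E * C by intros; ring,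
      choose_mul_hypergeometric hN]
    congr 1
    · congr 1
      · congr 1
        refine Finset.sum_congr rfl fun k _ => ?_
        simp
      · split_ifs <;> simp
    · simp
  · have : ∀ k, m.choose (k + n.natAbs) = 0 := fun k => Nat.choose_eq_zero_of_lt (by omega)
    have h0 : m.choose n.natAbs = 0 := Nat.choose_eq_zero_of_lt (by omega)
    simp [this, h0]

theorem sum_top (m N : ℕ) (x : ℂ) :
    (∑ k ∈ Finset.range (m - N + 1), (m.choose (k + N) : ℂ) * (m.choose k : ℂ) * x ^ k *
      (0 : ℂ) ^ (m - N - k)) = (m.choose N : ℂ) * x ^ (m - N) := by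
  rw [Finset.sum_range_succ, Finset.sum_eq_zero]
  · by_cases hN : N ≤ m
    · rw [Nat.sub_add_cancel hN, Nat.choose_symm hN]; simp
    · have h0 : m.choose (m - N + N) = 0 := Nat.choose_eq_zero_of_lt (by omega)
      simp [h0, Nat.choose_eq_zero_of_lt (not_le.1 hN)]
  · intro k hk
    have hk' := Finset.mem_range.1 hk
    rw [zero_pow (by omega)]; simp

theorem poissonMode_infty_coe (m : ℕ) (n : ℤ) (w : ℂ)
    (h : ((∞ : OnePoint ℂ), (w : OnePoint ℂ)) ∈ Omega) :
    poissonMode m n ⟨_, h⟩ = homMode m n 1 0 w 1 := by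
  have hw : w ≠ 0 := by
    rintro rfl
    simp [Omega, sphereMul] at h
  simp only [poissonMode, homMode, zero_mul, one_mul, zero_sub, sum_top]
  rcases lt_trichotomy n 0 with hn | rfl | hn
  · rw [if_pos hn.le, if_neg (by omega)]
    by_cases hN : n.natAbs ≤ m
    · have : w ^ m = w ^ (m - n.natAbs) * w ^ n.natAbs := by rw [← pow_add]; congr 1; omega
      rw [neg_pow w m, this, pow_add]
      have h4 : ((-1 : ℂ) ^ m) * (-1) ^ m = 1 := by rw [← mul_pow]; simp
      field_simp
      linear_combination (m.choose n.natAbs : ℂ) * h4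
    · simp [Nat.choose_eq_zero_of_lt (not_le.1 hN)]
  · have h4 : ((-1 : ℂ) ^ m) * (-1) ^ m = 1 := by rw [← mul_pow]; simp
    simp
    rw [neg_pow w m]
    field_simp
    linear_combination h4
  · rw [if_neg (by omega), if_pos (by omega), zero_pow (by omega)]; simp

theorem poissonMode_coe_infty (m : ℕ) (n : ℤ) (z : ℂ)
    (h : ((z : OnePoint ℂ), (∞ : OnePoint ℂ)) ∈ Omega) :
    poissonMode m n ⟨_, h⟩ = homMode m n z 1 1 0 := by
  have hz : z ≠ 0 := by
    rintro rfl
    simp [Omega, sphereMul] at h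
  simp only [poissonMode, homMode, mul_zero, mul_one, zero_sub, sum_top]
  rcases lt_trichotomy n 0 with hn | rfl | hn
  · rw [if_neg (by omega), if_neg (by omega), zero_pow (by omega)]; simp
  · have h4 : ((-1 : ℂ) ^ m) * (-1) ^ m = 1 := by rw [← mul_pow]; simp
    simp
    rw [neg_pow z m]
    field_simp
    linear_combination h4
  · rw [if_pos hn.le, if_pos (by omega), one_pow, mul_one]
    by_cases hN : n.natAbs ≤ m
    · have : z ^ m = z ^ (m - n.natAbs) * z ^ n.natAbs := by rw [← pow_add]; congr 1; omega
      rw [neg_pow z m, this, pow_add]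
      have h4 : ((-1 : ℂ) ^ m) * (-1) ^ m = 1 := by rw [← mul_pow]; simp
      field_simp
      linear_combination (m.choose n.natAbs : ℂ) * h4
    · simp [Nat.choose_eq_zero_of_lt (not_le.1 hN)]

theorem poissonMode_infty_infty (m : ℕ) (n : ℤ)
    (h : ((∞ : OnePoint ℂ), (∞ : OnePoint ℂ)) ∈ Omega) :
    poissonMode m n ⟨_, h⟩ = homMode m n 1 0 1 0 := by
  simp only [poissonMode, homMode, mul_zero, mul_one, zero_sub, sum_top, ite_self]
  by_cases hn : n = 0
  · subst hn
    have h4 : ((-1 : ℂ) ^ m) * (-1) ^ m = 1 := by rw [← mul_pow]; simp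
    simp
    field_simp
    linear_combination h4
  · rw [if_neg hn, zero_pow (by omega)]; simp

/-- Homogeneous coordinates of `chart i x`. -/
def num (i : Bool) (x : ℂ) : ℂ := if i then 1 else x

/-- Homogeneous coordinates of `chart i x`. -/
def den (i : Bool) (x : ℂ) : ℂ := if i then x else 1

theorem chart_mem_Omega (i j : Bool) (x y : ℂ) :
    (chart i x, chart j y) ∈ Omega ↔ den i x * den j y - num i x * num j y ≠ 0 := by
  rcases i <;> rcases j <;> by_cases hx : x = 0 <;> by_cases hy : y = 0 <;>
    simp [chart, num, den, Omega, sphereMul, hx, hy, sub_eq_zero]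
  · rw [eq_comm]
  · rw [← div_eq_mul_inv, div_eq_one_iff_eq hy, eq_comm]
  · rw [mul_comm, ← div_eq_mul_inv, div_eq_one_iff_eq hx, eq_comm]
  · rw [← mul_inv, inv_eq_one]

theorem pull_poissonMode (m : ℕ) (n : ℤ) (i j : Bool) (x y : ℂ)
    (h : (chart i x, chart j y) ∈ Omega) :
    pull (poissonMode m n) i j x y =
      homMode m n (num i x) (den i x) (num j y) (den j y) := by
  have hs : ∀ s : ℂ, s ≠ 0 → ∀ t : ℂ, t ≠ 0 → ∀ a b c d : ℂ,
    homMode m n a b c d = homMode m n (s * a) (s * b) (t * c) (t * d) :=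
      fun s hs t ht a b c d => (homMode_smul m n s t a b c d hs ht).symm
  rw [pull, dif_pos h]
  rcases i <;> rcases j <;> by_cases hx : x = 0 <;> by_cases hy : y = 0 <;>
    simp only [chart, num, den, hx, hy, if_true, if_false, Bool.false_eq_true] at h ⊢ <;>
    simp only [poissonMode_coe, poissonMode_infty_coe, poissonMode_coe_infty,
      poissonMode_infty_infty]
  · rw [hs 1 one_ne_zero y hy 0 1 y⁻¹ 1]; simp [hy]
  · rw [hs 1 one_ne_zero y hy x 1 y⁻¹ 1]; simp [hy]
  · rw [hs x hx 1 one_ne_zero x⁻¹ 1 0 1]; simp [hx]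
  · rw [hs x hx 1 one_ne_zero x⁻¹ 1 y 1]; simp [hx]
  · rw [hs 1 one_ne_zero y hy 1 0 y⁻¹ 1]; simp [hy]
  · rw [hs x hx 1 one_ne_zero x⁻¹ 1 1 0]; simp [hx]
  · rw [hs x hx y hy x⁻¹ 1 y⁻¹ 1]; simp [hx, hy]

/-- The Poisson Fourier modes are holomorphic on `Ω`, so their values at the points with an infinite
entry are those of the holomorphic extension of their values at the finite points. -/
theorem isHolomorphic_poissonMode (m : ℕ) (n : ℤ) : IsHolomorphic (poissonMode m n) := by
  intro i j
  have hnum : Differentiable ℂ (num i) ∧ Differentiable ℂ (den i) ∧ Differentiable ℂ (num j) ∧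
      Differentiable ℂ (den j) := by
    refine ⟨?_, ?_, ?_, ?_⟩
    · unfold num; split_ifs <;> fun_prop
    · unfold den; split_ifs <;> fun_prop
    · unfold num; split_ifs <;> fun_prop
    · unfold den; split_ifs <;> fun_prop
  obtain ⟨h1, h2, h3, h4⟩ := hnum
  have h5 : DifferentiableOn ℂ (fun q : ℂ × ℂ =>
      homMode m n (num i q.1) (den i q.1) (num j q.2) (den j q.2))
      {q : ℂ × ℂ | (chart i q.1, chart j q.2) ∈ Omega} := by
    intro q hq
    have hq' := pow_ne_zero m ((chart_mem_Omega i j q.1 q.2).1 hq)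
    apply DifferentiableAt.differentiableWithinAt
    unfold homMode
    by_cases hn : 0 ≤ n
    · simp only [hn, if_true]
      fun_prop (disch := exact hq')
    · simp only [hn, if_false]
      fun_prop (disch := exact hq')
  exact h5.congr fun q hq => pull_poissonMode m n i j q.1 q.2 hq

/-- The normalized modes
`Y_n^{-m} = √(2m+1) binom(m, |n|)^{-1/2} binom(-m-1, |n|)^{1/2} P_n^{-m}` (principal square roots;
`binom(-m-1, |n|)` is the generalized binomial coefficient, which is negative for odd `n`). -/
def normalizedMode (m : ℕ) (n : ℤ) (p : Omega) : ℂ :=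
  (Real.sqrt (2 * m + 1) : ℂ) * (m.choose n.natAbs : ℂ) ^ (-(1 / 2) : ℂ) *
    ((Ring.choose (-(m : ℤ) - 1) n.natAbs : ℤ) : ℂ) ^ (1 / 2 : ℂ) * poissonMode m n p

/-- The complex zonal harmonic `Z_m(p, q) = ∑_{j=-m}^m Y_j^{-m}(p) Y_{-j}^{-m}(q)`. -/
def zonal (m : ℕ) (p q : Omega) : ℂ :=
  ∑ j ∈ Finset.Icc (-(m : ℤ)) (m : ℤ), normalizedMode m j p * normalizedMode m (-j) q

/-- A point `(η, -conj η)`, `η ∈ ℂ`, of the rotated diagonal of `Ω` (the remaining point of the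
rotated diagonal is `(∞, ∞)`, which does not matter for integration). -/
def rotDiag (η : ℂ) : Omega :=
  ⟨((η : OnePoint ℂ), ((-(starRingEnd ℂ) η : ℂ) : OnePoint ℂ)), by
    have h : η * -(starRingEnd ℂ) η ≠ 1 := by
      rw [mul_neg, Complex.mul_conj]
      intro h
      have h2 := congrArg Complex.re h
      simp only [Complex.neg_re, Complex.ofReal_re, Complex.one_re] at h2
      linarith [Complex.normSq_nonneg η]
    intro h'
    exact h (OnePoint.coe_injective h')⟩

end

end ComplexZonal

/-!
The zonal harmonic is the reproducing kernel of a space of dimension `2 m + 1`, and everything follows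
from an explicit description of that space.

Up to sign, the modes `P_j^{-m}` with `j = m - k` are the coefficients of `s ^ k` in the generating
function `((1 + z s) (w + s) / (1 - z w)) ^ m` (`coeffMode`, `genMode`). In homogeneous coordinates
`z = a / b`, `w = c / d` they are the coefficients of the polynomial `((b + a x) (c + d x)) ^ m`, divided by
`(b d - a c) ^ m`. The weights in the definition of `Z_m` turn out to be those of the invariant bilinear
form `∑ (-1)^k k! (2 m - k)! A_k B_{2 m - k}` on polynomials of degree at most `2 m`
(`zonal_eq`). This makes the symmetry evident. The value of the form on `((b + a x) (c + d x)) ^ m` is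
`(-1)^m m!² (b d - a c)^{2 m}` (`invForm_modePoly`): the form is translation invariant, and after a
translation that moves a root of the polynomial to the origin only one term is left. This gives
`Z_m(p, p) = 2 m + 1`.

For the reproducing property, the eigenspace has to be spanned by the modes
(`exists_eq_sum_coeffMode`). Let `F` be an eigenfunction, at the finite points. Applying `∂_w^m` to the
equation of `(1 - z w)^m F` shows that `∂_w^{m+1} ((1 - z w)^m F) = (1 - z w)^m χ(w)` with `χ` entire
(`IsFiniteEigen.iterate_clearDenom`). Because `F(1, ·)` is bounded near `∞`, Cauchy's estimates at
`z = 1` force `χ` to vanish at `∞`, so that `χ = 0` and `F(0, ·)` is a polynomial of degree at most `m`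
(`IsFiniteEigen.eq_sum_snd`). The same holds for `F(·, 0)` by symmetry. A combination of modes has the
same restrictions to the axes, and an eigenfunction that vanishes on both axes is zero
(`IsFiniteEigen.eq_zero`), as integrating its equation twice shows near the origin.

It remains to pair the modes with each other over the rotated diagonal. The monomials
`η ^ k * conj η ^ l` are orthogonal there, and their norms are beta integrals proportional to
`k! (2 m - k)!`. So the pairing of the generating functions with parameters `s` and `σ` is the invariant
form once more, at `((1 + s x) (1 + σ x)) ^ m`, hence a multiple of `(σ - s)^{2 m}`
(`integral_genMode_mul`). Its coefficients are the pairings of the modes, and they are inverse to the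
weights in `Z_m`.
-/

namespace ComplexZonal

open Filter Topology Metric Polynomial MeasureTheory

/-! ### Separately holomorphic functions of two variables -/

/-- The partial derivative in the first variable. -/
noncomputable def derivFst (F : ℂ → ℂ → ℂ) (z w : ℂ) : ℂ := deriv (fun s => F s w) z

/-- The partial derivative in the second variable. -/
noncomputable def derivSnd (F : ℂ → ℂ → ℂ) (z w : ℂ) : ℂ := deriv (fun t => F z t) w

/-- Holomorphy on a subset `U` of `ℂ × ℂ`, in the form that is convenient for partial derivatives:
joint continuity together with complex differentiability in each variable. -/
structure SepHol (U : Set (ℂ × ℂ)) (F : ℂ → ℂ → ℂ) : Prop where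
  cont : ∀ z w, (z, w) ∈ U → ContinuousAt (fun q : ℂ × ℂ => F q.1 q.2) (z, w)
  fst : ∀ z w, (z, w) ∈ U → DifferentiableAt ℂ (fun s => F s w) z
  snd : ∀ z w, (z, w) ∈ U → DifferentiableAt ℂ (fun t => F z t) w

namespace SepHol

variable {U : Set (ℂ × ℂ)} {F G : ℂ → ℂ → ℂ}

theorem of_differentiableOn (hU : IsOpen U)
    (hF : DifferentiableOn ℂ (fun q : ℂ × ℂ => F q.1 q.2) U) : SepHol U F where
  cont z w h := (hF.differentiableAt (hU.mem_nhds h)).continuousAt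
  fst z w h := by
    have := hF.differentiableAt (hU.mem_nhds h)
    exact this.comp (f := fun s : ℂ => (s, w)) z (by fun_prop)
  snd z w h := by
    have := hF.differentiableAt (hU.mem_nhds h)
    exact this.comp (f := fun t : ℂ => (z, t)) w (by fun_prop)

theorem flip (h : SepHol U F) : SepHol (Prod.swap ⁻¹' U) (fun z w => F w z) where
  cont z w hz := by
    have := h.cont w z hz
    exact ContinuousAt.comp (f := fun q : ℂ × ℂ => (q.2, q.1)) (x := (z, w)) this (by fun_prop)
  fst z w hz := h.snd w z hz
  snd z w hz := h.fst w z hz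

theorem mul (hF : SepHol U F) (hG : SepHol U G) : SepHol U (fun z w => F z w * G z w) where
  cont z w h := (hF.cont z w h).mul (hG.cont z w h)
  fst z w h := (hF.fst z w h).mul (hG.fst z w h)
  snd z w h := (hF.snd z w h).mul (hG.snd z w h)

theorem sub (hF : SepHol U F) (hG : SepHol U G) : SepHol U (fun z w => F z w - G z w) where
  cont z w h := (hF.cont z w h).sub (hG.cont z w h)
  fst z w h := (hF.fst z w h).sub (hG.fst z w h)
  snd z w h := (hF.snd z w h).sub (hG.snd z w h)

theorem hasDerivAt_fst (h : SepHol U F) {z w : ℂ} (hz : (z, w) ∈ U) :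
    HasDerivAt (fun s => F s w) (derivFst F z w) z := (h.fst z w hz).hasDerivAt

theorem hasDerivAt_snd (h : SepHol U F) {z w : ℂ} (hz : (z, w) ∈ U) :
    HasDerivAt (fun t => F z t) (derivSnd F z w) w := (h.snd z w hz).hasDerivAt

theorem exists_ball_prod (hU : IsOpen U) {z w : ℂ} (hz : (z, w) ∈ U) :
    ∃ r > 0, ∀ s ∈ ball z r, ∀ t ∈ ball w r, (s, t) ∈ U := by
  obtain ⟨r, hr, h⟩ := Metric.isOpen_iff.1 hU _ hz
  refine ⟨r, hr, fun s hs t ht => h ?_⟩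
  rw [← ball_prod_same]
  exact ⟨hs, ht⟩

/-- As `w → w₀`, the holomorphic functions `F(·, w)` converge locally uniformly to `F(·, w₀)`, hence
so do their derivatives. -/
theorem continuousAt_derivFst (h : SepHol U F) (hU : IsOpen U) {z w : ℂ} (hz : (z, w) ∈ U) :
    ContinuousAt (fun q : ℂ × ℂ => derivFst F q.1 q.2) (z, w) := by
  obtain ⟨r, hr, hball⟩ := exists_ball_prod hU hz
  have hw : w ∈ ball w r := mem_ball_self hr
  have h1 : TendstoLocallyUniformlyOn (fun (q : ℂ × ℂ) s => F s q.2) (fun s => F s w)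
      (𝓝 (z, w)) (ball z r) := by
    rw [Metric.tendstoLocallyUniformlyOn_iff]
    intro ε hε x hx
    have hc := Metric.continuousAt_iff'.1 (h.cont x w (hball x hx w hw)) (ε / 2) (half_pos hε)
    rw [nhds_prod_eq] at hc
    obtain ⟨pa, ha, pb, hb, hab⟩ := eventually_prod_iff.1 hc
    refine ⟨{y | pa y}, mem_nhdsWithin_of_mem_nhds ha, ?_⟩
    have hb' : ∀ᶠ q : ℂ × ℂ in 𝓝 (z, w), pb q.2 := continuousAt_snd.eventually hb
    filter_upwards [hb'] with q hq y hy
    have e1 := hab hy hq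
    have e2 := hab hy hb.self_of_nhds
    simp only at e1 e2
    calc dist (F y w) (F y q.2) ≤ dist (F y w) (F x w) + dist (F y q.2) (F x w) :=
          dist_triangle_right _ _ _
      _ < ε := by linarith
  have hd : ∀ᶠ q : ℂ × ℂ in 𝓝 (z, w), DifferentiableOn ℂ (fun s => F s q.2) (ball z r) := by
    have : ∀ᶠ q : ℂ × ℂ in 𝓝 (z, w), q.2 ∈ ball w r :=
      continuousAt_snd.eventually (isOpen_ball.mem_nhds hw)
    filter_upwards [this] with q hq s hs
    exact (h.fst s q.2 (hball s hs _ hq)).differentiableWithinAt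
  have h2 := h1.deriv hd isOpen_ball
  have h3 : DifferentiableOn ℂ (fun s => F s w) (ball z r) := fun s hs =>
    (h.fst s w (hball s hs _ hw)).differentiableWithinAt
  have h4 : ContinuousAt (deriv fun s => F s w) z :=
    ((h3.deriv isOpen_ball).differentiableAt (ball_mem_nhds z hr)).continuousAt
  have h5 := h2.tendsto_comp (g := Prod.fst) h4.continuousWithinAt (mem_ball_self hr) (by
    rw [nhdsWithin_eq_nhds.2 (ball_mem_nhds z hr)]
    exact continuousAt_fst)
  exact h5

theorem continuousAt_derivSnd (h : SepHol U F) (hU : IsOpen U) {z w : ℂ} (hz : (z, w) ∈ U) :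
    ContinuousAt (fun q : ℂ × ℂ => derivSnd F q.1 q.2) (z, w) := by
  have h1 := h.flip.continuousAt_derivFst (hU.preimage continuous_swap) (z := w) (w := z) hz
  exact ContinuousAt.comp (f := fun q : ℂ × ℂ => (q.2, q.1)) (x := (z, w)) h1 (by fun_prop)

/-- The difference quotients in the second variable converge locally uniformly in the first one. -/
theorem tendstoLocallyUniformlyOn_slope (h : SepHol U F) (hU : IsOpen U) 
    {z₀ w₀ : ℂ} {r : ℝ} (hr : 0 < r)
    (hball : ∀ s ∈ ball z₀ r, ∀ t ∈ ball w₀ r, (s, t) ∈ U) :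
    TendstoLocallyUniformlyOn (fun (k : ℂ) s => k⁻¹ * (F s (w₀ + k) - F s w₀))
      (fun s => derivSnd F s w₀) (𝓝[≠] 0) (ball z₀ r) := by
  have hw : w₀ ∈ ball w₀ r := mem_ball_self hr
  rw [Metric.tendstoLocallyUniformlyOn_iff]
  intro ε hε x hx
  have hxU := hball x hx w₀ hw
  have hc := Metric.continuousAt_iff'.1 (h.continuousAt_derivSnd hU hxU) (ε / 4) (by positivity)
  have hc' := hc.and (hU.mem_nhds hxU)
  obtain ⟨δ, hδ, hδ'⟩ := Metric.eventually_nhds_iff_ball.1 hc'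
  rw [← ball_prod_same] at hδ'
  refine ⟨ball x δ, mem_nhdsWithin_of_mem_nhds (ball_mem_nhds x hδ), ?_⟩
  have hk : ∀ᶠ k : ℂ in 𝓝[≠] 0, k ∈ ball (0 : ℂ) δ :=
    mem_nhdsWithin_of_mem_nhds (ball_mem_nhds 0 hδ)
  filter_upwards [hk, self_mem_nhdsWithin] with k hk hk0 y hy
  have hk0 : k ≠ 0 := hk0
  -- the mean value inequality for the remainder of first order in `t`
  have key : ‖(fun t => F y t - t * derivSnd F y w₀) (w₀ + k) -
      (fun t => F y t - t * derivSnd F y w₀) w₀‖ ≤ (ε / 2) * ‖(w₀ + k) - w₀‖ := by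
    refine Convex.norm_image_sub_le_of_norm_hasDerivWithin_le (s := ball w₀ δ)
      (f := fun t => F y t - t * derivSnd F y w₀)
      (f' := fun t => derivSnd F y t - 1 * derivSnd F y w₀) ?_ ?_
      (convex_ball w₀ δ) (mem_ball_self hδ) ?_
    · intro t ht
      have hU' := (hδ' (y, t) ⟨hy, ht⟩).2
      exact ((h.hasDerivAt_snd hU').sub ((hasDerivAt_id t).mul_const _)).hasDerivWithinAt
    · intro t ht
      have e1 := (hδ' (y, t) ⟨hy, ht⟩).1
      have e2 := (hδ' (y, w₀) ⟨hy, mem_ball_self hδ⟩).1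
      simp only at e1 e2
      rw [one_mul, ← dist_eq_norm]
      linarith [dist_triangle_right (derivSnd F y t) (derivSnd F y w₀) (derivSnd F x w₀)]
    · simpa using hk
  have e3 : derivSnd F y w₀ - k⁻¹ * (F y (w₀ + k) - F y w₀) =
      -(k⁻¹ * ((F y (w₀ + k) - (w₀ + k) * derivSnd F y w₀) - (F y w₀ - w₀ * derivSnd F y w₀))) := by
    field_simp
    ring
  rw [dist_eq_norm, e3, norm_neg, norm_mul, norm_inv]
  have hkp : 0 < ‖k‖ := norm_pos_iff.2 hk0
  simp only [add_sub_cancel_left] at key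
  calc ‖k‖⁻¹ * _ ≤ ‖k‖⁻¹ * (ε / 2 * ‖k‖) := by gcongr
    _ = ε / 2 := by field_simp
    _ < ε := half_lt_self hε

/-- A locally uniform limit of holomorphic functions is holomorphic, and its derivative is the limit of
their derivatives. -/
theorem differentiableAt_derivSnd_fst (h : SepHol U F) (hU : IsOpen U) {z w : ℂ}
    (hz : (z, w) ∈ U) : DifferentiableAt ℂ (fun s => derivSnd F s w) z ∧
      Tendsto (fun k : ℂ => k⁻¹ * (derivFst F z (w + k) - derivFst F z w)) (𝓝[≠] 0)
        (𝓝 (derivFst (derivSnd F) z w)) := by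
  obtain ⟨r, hr, hball⟩ := exists_ball_prod hU hz
  have h1 := h.tendstoLocallyUniformlyOn_slope hU hr hball
  have hw : w ∈ ball w r := mem_ball_self hr
  have hk : ∀ᶠ k : ℂ in 𝓝[≠] 0, w + k ∈ ball w r := by
    filter_upwards [mem_nhdsWithin_of_mem_nhds (ball_mem_nhds (0 : ℂ) hr)] with k hk
    simpa using hk
  have hd : ∀ᶠ k : ℂ in 𝓝[≠] 0,
      DifferentiableOn ℂ (fun s => k⁻¹ * (F s (w + k) - F s w)) (ball z r) := by
    filter_upwards [hk] with k hk s hs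
    exact (((h.fst s _ (hball s hs _ hk)).sub
      (h.fst s w (hball s hs _ hw))).const_mul _).differentiableWithinAt
  refine ⟨(h1.differentiableOn hd isOpen_ball).differentiableAt (ball_mem_nhds z hr), ?_⟩
  refine ((h1.deriv hd isOpen_ball).tendsto_at (mem_ball_self hr)).congr' ?_
  filter_upwards [hk] with k hk
  exact (((h.hasDerivAt_fst (hball z (mem_ball_self hr) _ hk)).sub
    (h.hasDerivAt_fst hz)).const_mul _).deriv

theorem partialSnd (h : SepHol U F) (hU : IsOpen U) : SepHol U (derivSnd F) where
  cont z w hz := h.continuousAt_derivSnd hU hz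
  fst z w hz := (h.differentiableAt_derivSnd_fst hU hz).1
  snd z w hz := by
    have h1 : DifferentiableOn ℂ (fun t => F z t) {t | (z, t) ∈ U} := fun t ht =>
      (h.snd z t ht).differentiableWithinAt
    have ho : IsOpen {t | (z, t) ∈ U} := hU.preimage (by fun_prop)
    exact (h1.deriv ho).differentiableAt (ho.mem_nhds hz)

theorem partialFst (h : SepHol U F) (hU : IsOpen U) : SepHol U (derivFst F) :=
  (h.flip.partialSnd (hU.preimage continuous_swap)).flip

theorem derivFst_derivSnd (h : SepHol U F) (hU : IsOpen U) {z w : ℂ} (hz : (z, w) ∈ U) :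
    derivFst (derivSnd F) z w =
      derivSnd (derivFst F) z w := by
  have h1 := (h.differentiableAt_derivSnd_fst hU hz).2
  have h2 := hasDerivAt_iff_tendsto_slope_zero.1 ((h.partialFst hU).hasDerivAt_snd hz)
  exact tendsto_nhds_unique h1 (by simpa [smul_eq_mul] using h2)

end SepHol

/-! ### Eigenfunctions at the finite points -/

/-- The finite part `{(z, w) : z w ≠ 1}` of `Ω`. -/
def finiteOmega : Set (ℂ × ℂ) := {q | q.1 * q.2 ≠ 1}

theorem isOpen_finiteOmega : IsOpen finiteOmega :=
  isOpen_ne_fun (by fun_prop) (by fun_prop)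

theorem isPreconnected_mul_ne_one (w : ℂ) : IsPreconnected {s : ℂ | s * w ≠ 1} := by
  have h : Set.Countable {s : ℂ | s * w = 1} :=
    (Set.countable_singleton w⁻¹).mono fun s hs => eq_inv_of_mul_eq_one_left hs
  exact (h.isPathConnected_compl_of_one_lt_rank (by simp)).isConnected.isPreconnected

/-- Holomorphic functions on the finite part of `Ω` with `(1 - z w)² ∂_z ∂_w F = m (m + 1) F`. -/
structure IsFiniteEigen (m : ℕ) (F : ℂ → ℂ → ℂ) : Prop where
  hol : SepHol finiteOmega F
  eqn : ∀ z w, z * w ≠ 1 →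
    (1 - z * w) ^ 2 * derivFst (derivSnd F) z w = m * (m + 1) * F z w

namespace IsFiniteEigen

variable {m : ℕ} {F G : ℂ → ℂ → ℂ}

theorem flip (h : IsFiniteEigen m F) : IsFiniteEigen m (fun z w => F w z) := by
  have e : Prod.swap ⁻¹' finiteOmega = finiteOmega := by
    ext q
    simp [finiteOmega, mul_comm]
  refine ⟨e ▸ h.hol.flip, fun z w hzw => ?_⟩
  have h1 := h.eqn w z (by rwa [mul_comm])
  rw [h.hol.derivFst_derivSnd isOpen_finiteOmega (show w * z ≠ 1 by rwa [mul_comm])] at h1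
  rw [mul_comm z w]
  exact h1

theorem sub (hF : IsFiniteEigen m F) (hG : IsFiniteEigen m G) :
    IsFiniteEigen m (fun z w => F z w - G z w) := by
  refine ⟨hF.hol.sub hG.hol, fun z w hzw => ?_⟩
  have h1 : ∀ᶠ s in 𝓝 z, derivSnd (fun z w => F z w - G z w) s w =
      derivSnd F s w - derivSnd G s w := by
    have ho : IsOpen {s : ℂ | s * w ≠ 1} := isOpen_ne_fun (by fun_prop) (by fun_prop)
    filter_upwards [ho.mem_nhds hzw] with s hs
    exact ((hF.hol.hasDerivAt_snd hs).sub (hG.hol.hasDerivAt_snd hs)).deriv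
  have h2 : derivFst (derivSnd fun z w => F z w - G z w) z w =
      derivFst (derivSnd F) z w - derivFst (derivSnd G) z w := by
    have h3 := ((hF.hol.partialSnd isOpen_finiteOmega).hasDerivAt_fst hzw).sub
      ((hG.hol.partialSnd isOpen_finiteOmega).hasDerivAt_fst hzw)
    exact (EventuallyEq.deriv_eq h1).trans h3.deriv
  rw [h2]
  linear_combination hF.eqn z w hzw - hG.eqn z w hzw

end IsFiniteEigen

theorem hasDerivAt_one_sub_mul_pow (m : ℕ) {z w : ℂ} (h : z * w ≠ 1) :
    HasDerivAt (fun t => (1 - z * t) ^ m) (-(m * z) * ((1 - z * w) ^ m / (1 - z * w))) w := by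
  have h0 : 1 - z * w ≠ 0 := sub_ne_zero.2 (Ne.symm h)
  have h1 : HasDerivAt (fun t => 1 - z * t) (-z) w := by
    simpa using ((hasDerivAt_id w).const_mul z).const_sub 1
  refine (h1.pow m).congr_deriv ?_
  rcases m with _ | m
  · simp
  · rw [pow_succ (1 - z * w) m, mul_div_assoc, div_self h0]
    simp
    ring

/-- The function `(1 - z w)^m F`. For an eigenfunction `F` it satisfies an equation whose coefficients
are polynomials of low degree. -/
noncomputable def clearDenom (m : ℕ) (F : ℂ → ℂ → ℂ) (z w : ℂ) : ℂ := (1 - z * w) ^ m * F z w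

theorem SepHol.clearDenom {F : ℂ → ℂ → ℂ} (m : ℕ) (h : SepHol finiteOmega F) :
    SepHol finiteOmega (clearDenom m F) := by
  refine SepHol.mul (F := fun z w => (1 - z * w) ^ m) ⟨fun z w _ => ?_, fun z w _ => ?_,
    fun z w _ => ?_⟩ h
  · exact Continuous.continuousAt (by fun_prop)
  · fun_prop
  · fun_prop

variable {m : ℕ} {F : ℂ → ℂ → ℂ}

theorem derivSnd_clearDenom (hF : SepHol finiteOmega F) {z w : ℂ} (h : z * w ≠ 1) :
    derivSnd (clearDenom m F) z w =
      (1 - z * w) ^ m * (derivSnd F z w - m * z * F z w / (1 - z * w)) := by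
  have h0 : 1 - z * w ≠ 0 := sub_ne_zero.2 (Ne.symm h)
  refine (((hasDerivAt_one_sub_mul_pow m h).mul (hF.hasDerivAt_snd h)).deriv).trans ?_
  field_simp
  ring

theorem derivFst_clearDenom (hF : SepHol finiteOmega F) {z w : ℂ} (h : z * w ≠ 1) :
    derivFst (clearDenom m F) z w =
      (1 - z * w) ^ m * (derivFst F z w - m * w * F z w / (1 - z * w)) := by
  have h0 : 1 - z * w ≠ 0 := sub_ne_zero.2 (Ne.symm h)
  have h' := hasDerivAt_one_sub_mul_pow m (z := w) (w := z) (by rwa [mul_comm])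
  simp only [mul_comm w] at h'
  refine ((h'.mul (hF.hasDerivAt_fst h)).deriv).trans ?_
  field_simp
  ring

theorem IsFiniteEigen.clearDenom_eqn (hF : IsFiniteEigen m F) {z w : ℂ} (h : z * w ≠ 1) :
    (1 - z * w) * derivFst (derivSnd (clearDenom m F)) z w + m * z * derivFst (clearDenom m F) z w
      + m * w * derivSnd (clearDenom m F) z w - m ^ 2 * clearDenom m F z w = 0 := by
  have h0 : 1 - z * w ≠ 0 := sub_ne_zero.2 (Ne.symm h)
  have ho : IsOpen {s : ℂ | s * w ≠ 1} := isOpen_ne_fun (by fun_prop) (by fun_prop)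
  have h1 : (fun s => derivSnd (clearDenom m F) s w) =ᶠ[𝓝 z]
      fun s => (1 - s * w) ^ m * (derivSnd F s w - m * s * F s w / (1 - s * w)) := by
    filter_upwards [ho.mem_nhds h] with s hs
    exact derivSnd_clearDenom hF.hol hs
  have hC : HasDerivAt (fun s => 1 - s * w) (-w) z := by
    simpa using ((hasDerivAt_id z).mul_const w).const_sub 1
  have h' := hasDerivAt_one_sub_mul_pow m (z := w) (w := z) (by rwa [mul_comm])
  simp only [mul_comm w] at h'
  have h2 := h'.mul (((hF.hol.partialSnd isOpen_finiteOmega).hasDerivAt_fst h).sub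
    ((((hasDerivAt_id z).const_mul (m : ℂ)).mul (hF.hol.hasDerivAt_fst h)).div hC h0))
  have h3 := (EventuallyEq.deriv_eq h1).trans h2.deriv
  have h4 : derivFst (derivSnd (clearDenom m F)) z w = _ := h3
  have h5 := hF.eqn z w h
  rw [h4, derivFst_clearDenom hF.hol h, derivSnd_clearDenom hF.hol h, clearDenom]
  simp only [Pi.sub_apply, Pi.div_apply, Pi.mul_apply, id, mul_one]
  field_simp
  linear_combination (1 - z * w) ^ m * h5

theorem SepHol.iterate_derivSnd {U : Set (ℂ × ℂ)} (hU : IsOpen U) (hF : SepHol U F) (k : ℕ) :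
    SepHol U (derivSnd^[k] F) := by
  induction k with
  | zero => exact hF
  | succ k ih => rw [Function.iterate_succ_apply']; exact ih.partialSnd hU

/-- The `k`-fold `w`-derivative of the equation of `clearDenom m F`. The coefficient `m - k` is what makes
`k = m` special. -/
theorem IsFiniteEigen.iterate_clearDenom_eqn (hF : IsFiniteEigen m F) (k : ℕ) {z w : ℂ}
    (h : z * w ≠ 1) :
    (1 - z * w) * derivFst (derivSnd^[k + 1] (clearDenom m F)) z w
      + (m - k) * (z * derivFst (derivSnd^[k] (clearDenom m F)) z w)
      + m * (w * (derivSnd^[k + 1] (clearDenom m F)) z w)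
      + m * (k - m) * (derivSnd^[k] (clearDenom m F)) z w = 0 := by
  induction k generalizing z w with
  | zero =>
    have := hF.clearDenom_eqn h
    simp only [Function.iterate_succ_apply', Function.iterate_zero, id]
    push_cast
    linear_combination this
  | succ k ih =>
    have hU := isOpen_finiteOmega
    have hs : ∀ j, SepHol finiteOmega (derivSnd^[j] (clearDenom m F)) :=
      (hF.hol.clearDenom m).iterate_derivSnd hU
    have ho : IsOpen {t : ℂ | z * t ≠ 1} := isOpen_ne_fun (by fun_prop) (by fun_prop)
    have hC : HasDerivAt (fun t => 1 - z * t) (-z) w := by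
      simpa using ((hasDerivAt_id w).const_mul z).const_sub 1
    have e : ∀ j, HasDerivAt (fun t => (derivSnd^[j] (clearDenom m F)) z t)
        ((derivSnd^[j + 1] (clearDenom m F)) z w) w := fun j => by
      rw [Function.iterate_succ_apply']
      exact (hs j).hasDerivAt_snd h
    have e' : ∀ j, HasDerivAt (fun t => derivFst (derivSnd^[j] (clearDenom m F)) z t)
        (derivFst (derivSnd^[j + 1] (clearDenom m F)) z w) w := fun j => by
      rw [Function.iterate_succ_apply', (hs j).derivFst_derivSnd hU h]
      exact ((hs j).partialFst hU).hasDerivAt_snd h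
    have hd := (((hC.mul (e' (k + 1))).add (((e' k).const_mul z).const_mul ((m : ℂ) - k))).add
      (((hasDerivAt_id w).mul (e (k + 1))).const_mul (m : ℂ))).add
      ((e k).const_mul ((m : ℂ) * (k - m)))
    have hz : HasDerivAt (fun _ : ℂ => (0 : ℂ)) 0 w := hasDerivAt_const _ _
    have hd0 := hd.unique (hz.congr_of_eventuallyEq (by
      filter_upwards [ho.mem_nhds h] with t ht
      exact ih ht))
    simp only [id] at hd0
    push_cast
    linear_combination hd0

/-- The function `∂_w^{m+1} ((1 - z w)^m F)` is the product of `(1 - z w)^m` and a function of `w`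
alone. -/
theorem IsFiniteEigen.iterate_clearDenom (hF : IsFiniteEigen m F) {z w : ℂ} (h : z * w ≠ 1) :
    (derivSnd^[m + 1] (clearDenom m F)) z w =
      (1 - z * w) ^ m * (derivSnd^[m + 1] (clearDenom m F)) 0 w := by
  have hU := isOpen_finiteOmega
  have hs := (hF.hol.clearDenom m).iterate_derivSnd hU (m + 1)
  have ho : IsOpen {s : ℂ | s * w ≠ 1} := isOpen_ne_fun (by fun_prop) (by fun_prop)
  -- for `k = m` the equation says that the quotient by `(1 - z w)^m` does not depend on `z`
  have hd : ∀ s, s * w ≠ 1 →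
      HasDerivAt (fun s => (derivSnd^[m + 1] (clearDenom m F)) s w / (1 - s * w) ^ m) 0 s := by
    intro s hs'
    have h0 : 1 - s * w ≠ 0 := sub_ne_zero.2 (Ne.symm hs')
    have h' := hasDerivAt_one_sub_mul_pow m (z := w) (w := s) (by rwa [mul_comm])
    simp only [mul_comm w] at h'
    refine ((hs.hasDerivAt_fst hs').div h' (pow_ne_zero m h0)).congr_deriv ?_
    have := hF.iterate_clearDenom_eqn m hs'
    field_simp
    linear_combination this
  have := ho.is_const_of_deriv_eq_zero (isPreconnected_mul_ne_one w)
    (fun s hs => (hd s hs).differentiableAt.differentiableWithinAt)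
    (fun s hs => (hd s hs).deriv) h (y := 0) (by simp)
  have h0 : 1 - z * w ≠ 0 := sub_ne_zero.2 (Ne.symm h)
  simp only [zero_mul, sub_zero, one_pow, div_one] at this
  rw [← this]
  field_simp

/-! ### Restriction of eigenfunctions to the axes -/

theorem iterate_derivSnd_apply (G : ℂ → ℂ → ℂ) (k : ℕ) (z w : ℂ) :
    (derivSnd^[k] G) z w = iteratedDeriv k (G z) w := by
  induction k generalizing w with
  | zero => simp
  | succ k ih =>
    rw [Function.iterate_succ_apply', iteratedDeriv_succ]
    exact congrArg (fun f => deriv f w) (funext fun t => ih t)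

theorem eq_sum_of_iteratedDeriv_eq_zero {f : ℂ → ℂ} (hf : Differentiable ℂ f) {n : ℕ}
    (h : ∀ w, iteratedDeriv n f w = 0) :
    ∃ α : ℕ → ℂ, ∀ w, f w = ∑ k ∈ Finset.range n, α k * w ^ k := by
  have h' : ∀ j, iteratedDeriv (n + j) f = 0 := by
    intro j
    induction j with
    | zero => exact funext h
    | succ j ih =>
      rw [← add_assoc, iteratedDeriv_succ, ih]
      exact funext fun w => deriv_const w 0
  refine ⟨fun k => (k.factorial : ℂ)⁻¹ * iteratedDeriv k f 0, fun w => ?_⟩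
  rw [← Complex.taylorSeries_eq_of_entire' 0 w hf, tsum_eq_sum (s := Finset.range n)]
  · simp
  · intro k hk
    obtain ⟨j, rfl⟩ := Nat.exists_eq_add_of_le (not_lt.1 fun h => hk (Finset.mem_range.2 h))
    simp [h']

/-- If `F(1, ·)` is bounded near `∞`, then `F(0, ·)` is a polynomial of degree at most `m`. Indeed
`∂_w^{m+1} ((1 - z w)^m F) = (1 - z w)^m χ(w)` with `χ` entire; for `z = 1` Cauchy's estimates show
that `χ` vanishes at `∞`, so `χ = 0` by Liouville's theorem. -/
theorem IsFiniteEigen.eq_sum_snd (hF : IsFiniteEigen m F) {C R : ℝ}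
    (hb : ∀ w, R ≤ ‖w‖ → ‖F 1 w‖ ≤ C) :
    ∃ α : ℕ → ℂ, ∀ w, F 0 w = ∑ k ∈ Finset.range (m + 1), α k * w ^ k := by
  have h0 : clearDenom m F 0 = F 0 := by
    ext w
    simp [clearDenom]
  have hF0 : Differentiable ℂ (F 0) := fun w => hF.hol.snd 0 w (by simp [finiteOmega])
  have key : ∀ w, w ≠ 1 → iteratedDeriv (m + 1) (clearDenom m F 1) w =
      (1 - w) ^ m * iteratedDeriv (m + 1) (F 0) w := by
    intro w hw
    have := hF.iterate_clearDenom (z := 1) (w := w) (by simpa using hw)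
    rwa [iterate_derivSnd_apply, iterate_derivSnd_apply, h0, one_mul] at this
  have hd : Differentiable ℂ (iteratedDeriv (m + 1) (F 0)) :=
    (hF0.contDiff (n := ⊤)).differentiable_iteratedDeriv _ (by exact_mod_cast WithTop.coe_lt_top _)
  have hbound : ∀ w : ℂ, max (2 * R) 4 ≤ ‖w‖ →
      ‖iteratedDeriv (m + 1) (F 0) w‖ ≤ (m + 1).factorial * C * 4 ^ m * 2 / ‖w‖ := by
    intro w hw
    have hw1 := (le_max_left _ _).trans hw
    have hw2 := (le_max_right _ _).trans hw
    set r := ‖w‖ with hr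
    -- the disc with center `w` and radius `‖w‖ / 2` avoids `1` and lies where `F(1, ·)` is bounded
    have hζ : ∀ ζ ∈ closedBall w (r / 2), r / 2 ≤ ‖ζ‖ ∧ ‖ζ‖ ≤ 3 / 2 * r := by
      intro ζ hζ
      rw [mem_closedBall, dist_eq_norm] at hζ
      have h1 := norm_sub_norm_le w ζ
      have h2 := norm_sub_norm_le ζ w
      rw [norm_sub_rev] at h1
      constructor <;> linarith
    have hζ1 : ∀ ζ ∈ closedBall w (r / 2), ζ ≠ 1 := by
      rintro ζ h rfl
      have := (hζ 1 h).1
      rw [norm_one] at this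
      linarith
    have hrpos : 0 < r / 2 := by linarith
    have hdc : DiffContOnCl ℂ (clearDenom m F 1) (ball w (r / 2)) := by
      apply DifferentiableOn.diffContOnCl
      intro ζ h
      rw [closure_ball w hrpos.ne'] at h
      exact ((hF.hol.clearDenom m).snd 1 ζ
        (by simpa [finiteOmega] using hζ1 ζ h)).differentiableWithinAt
    have hC : ∀ ζ ∈ sphere w (r / 2), ‖clearDenom m F 1 ζ‖ ≤ (2 * r) ^ m * C := by
      intro ζ h
      have h' := hζ ζ (sphere_subset_closedBall h)
      rw [clearDenom, one_mul, norm_mul, norm_pow]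
      have h1 : ‖1 - ζ‖ ≤ 2 * r := by
        have := norm_sub_le 1 ζ
        rw [norm_one] at this
        linarith
      have h2 := hb ζ (by linarith)
      gcongr
    have hcau := Complex.norm_iteratedDeriv_le_of_forall_mem_sphere_norm_le (m + 1) hrpos hdc hC
    rw [key w (hζ1 w (mem_closedBall_self hrpos.le)), norm_mul, norm_pow] at hcau
    have h1 : r / 2 ≤ ‖1 - w‖ := by
      have := norm_sub_norm_le w 1
      rw [norm_one, norm_sub_rev] at this
      linarith
    have hC0 : 0 ≤ C := (norm_nonneg _).trans (hb w (by linarith))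
    have h2 : (r / 2) ^ m * ‖iteratedDeriv (m + 1) (F 0) w‖ ≤
        (m + 1).factorial * ((2 * r) ^ m * C) / (r / 2) ^ (m + 1) :=
      (mul_le_mul_of_nonneg_right (pow_le_pow_left₀ hrpos.le h1 m) (norm_nonneg _)).trans hcau
    have h3 : (2 * r) ^ m = 4 ^ m * (r / 2) ^ m := by rw [← mul_pow]; congr 1; ring
    rw [h3, show ((m + 1).factorial : ℝ) * (4 ^ m * (r / 2) ^ m * C) / (r / 2) ^ (m + 1) =
      (r / 2) ^ m * ((m + 1).factorial * C * 4 ^ m / (r / 2) ^ (m + 1)) by ring] at h2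
    refine (le_of_mul_le_mul_left h2 (pow_pos hrpos m)).trans ?_
    rw [show ((m + 1).factorial : ℝ) * C * 4 ^ m * 2 / r =
      (m + 1).factorial * C * 4 ^ m / (r / 2) by field_simp]
    have h4 : r / 2 ≤ (r / 2) ^ (m + 1) := le_self_pow₀ (by linarith) (by omega)
    gcongr
  have hlim : Tendsto (iteratedDeriv (m + 1) (F 0)) (cocompact ℂ) (𝓝 0) := by
    have hn := tendsto_norm_cocompact_atTop (E := ℂ)
    refine squeeze_zero_norm' ?_ (hn.const_div_atTop ((m + 1).factorial * C * 4 ^ m * 2))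
    filter_upwards [hn.eventually_ge_atTop (max (2 * R) 4)] with w hw
    exact hbound w hw
  exact eq_sum_of_iteratedDeriv_eq_zero hF0 fun w => hd.apply_eq_of_tendsto_cocompact w hlim

/-- An eigenfunction that vanishes on both axes vanishes near the origin: in a small bidisc,
integrating the equation twice bounds its supremum by a quarter of itself. -/
theorem IsFiniteEigen.eq_zero_near (hF : IsFiniteEigen m F) (h1 : ∀ z, F z 0 = 0)
    (h2 : ∀ w, F 0 w = 0) :
    ∃ δ > 0, ∀ z w : ℂ, ‖z‖ ≤ δ → ‖w‖ ≤ δ → F z w = 0 := by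
  have hm : (0 : ℝ) < m + 1 := by positivity
  -- the integrations lose the factors `4 m (m + 1)`, as `|1 - z w|⁻² ≤ 4`, and `δ²`
  set δ : ℝ := 1 / (4 * (m + 1)) with hδdef
  have hδ : 0 < δ := by positivity
  have hδ1 : δ ≤ 1 / 2 := by
    rw [hδdef]
    apply one_div_le_one_div_of_le <;> nlinarith
  have hzw : ∀ z w : ℂ, ‖z‖ ≤ δ → ‖w‖ ≤ δ → 1 / 2 ≤ ‖1 - z * w‖ := by
    intro z w hz hw
    have h3 := norm_sub_norm_le 1 (z * w)
    have h4 : ‖z * w‖ ≤ 1 / 2 * (1 / 2) := by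
      rw [norm_mul]
      exact mul_le_mul (hz.trans hδ1) (hw.trans hδ1) (norm_nonneg _) (by norm_num)
    rw [norm_one] at h3
    linarith
  have hmem : ∀ z w : ℂ, ‖z‖ ≤ δ → ‖w‖ ≤ δ → z * w ≠ 1 := by
    intro z w hz hw h
    have := hzw z w hz hw
    rw [h] at this
    norm_num at this
  have hK : IsCompact (closedBall (0 : ℂ) δ ×ˢ closedBall (0 : ℂ) δ) :=
    (isCompact_closedBall _ _).prod (isCompact_closedBall _ _)
  obtain ⟨p, hp, hmax⟩ := hK.exists_isMaxOn (f := fun q : ℂ × ℂ => ‖F q.1 q.2‖)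
    ⟨(0, 0), by simp [hδ.le]⟩ (fun q hq => by
      simp only [Set.mem_prod, mem_closedBall_zero_iff] at hq
      exact (hF.hol.cont q.1 q.2 (hmem _ _ hq.1 hq.2)).norm.continuousWithinAt)
  set M := ‖F p.1 p.2‖ with hM
  have hle : ∀ z w : ℂ, ‖z‖ ≤ δ → ‖w‖ ≤ δ → ‖F z w‖ ≤ M := fun z w hz hw =>
    hmax (show (z, w) ∈ _ by simp [hz, hw])
  have hU := isOpen_finiteOmega
  have hsnd : ∀ z w : ℂ, ‖z‖ ≤ δ → ‖w‖ ≤ δ →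
      ‖derivSnd F z w‖ ≤ 4 * (m * (m + 1)) * M * δ := by
    intro z w hz hw
    have e := Convex.norm_image_sub_le_of_norm_hasDerivWithin_le (s := closedBall (0 : ℂ) δ)
      (f := fun s => derivSnd F s w) (f' := fun s => derivFst (derivSnd F) s w)
      (C := 4 * (m * (m + 1)) * M) (x := 0) (y := z)
      (fun s hs => ((hF.hol.partialSnd hU).hasDerivAt_fst
        (hmem s w (mem_closedBall_zero_iff.1 hs) hw)).hasDerivWithinAt)
      (fun s hs => by
        have hs := mem_closedBall_zero_iff.1 hs
        have e1 := congrArg norm (hF.eqn s w (hmem s w hs hw))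
        have e2 := hzw s w hs hw
        have e3 := hle s w hs hw
        rw [norm_mul, norm_pow, norm_mul, norm_mul, Complex.norm_natCast,
          show ((m : ℂ) + 1) = ((m + 1 : ℕ) : ℂ) by push_cast; rfl, Complex.norm_natCast] at e1
        push_cast at e1
        have e4 : (1 / 2 : ℝ) ^ 2 ≤ ‖1 - s * w‖ ^ 2 := by gcongr
        have e5 := mul_le_mul_of_nonneg_right e4 (norm_nonneg (derivFst (derivSnd F) s w))
        have e6 : (m * (m + 1) : ℝ) * ‖F s w‖ ≤ m * (m + 1) * M := by gcongr
        nlinarith)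
      (convex_closedBall 0 δ) (by simp [hδ.le]) (by simpa using hz)
    have e0 : derivSnd F 0 w = 0 := by
      rw [derivSnd, show (fun t => F 0 t) = fun _ => 0 from funext h2]
      exact deriv_const _ _
    simp only [e0, sub_zero] at e
    refine e.trans ?_
    gcongr
  have hfin : M ≤ 4 * (m * (m + 1)) * M * δ * δ := by
    have hp' : ‖p.1‖ ≤ δ ∧ ‖p.2‖ ≤ δ := by simpa using hp
    have e := Convex.norm_image_sub_le_of_norm_hasDerivWithin_le (s := closedBall (0 : ℂ) δ)
      (f := fun t => F p.1 t) (f' := fun t => derivSnd F p.1 t)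
      (C := 4 * (m * (m + 1)) * M * δ) (x := 0) (y := p.2)
      (fun t ht => (hF.hol.hasDerivAt_snd
        (show (p.1, t) ∈ finiteOmega from
        hmem p.1 t hp'.1 (mem_closedBall_zero_iff.1 ht))).hasDerivWithinAt)
      (fun t ht => hsnd p.1 t hp'.1 (mem_closedBall_zero_iff.1 ht))
      (convex_closedBall 0 δ) (by simp [hδ.le]) (by simpa using hp'.2)
    simp only [h1, sub_zero] at e
    refine e.trans ?_
    have := hp'.2
    gcongr
  have hM0 : M = 0 := by
    have hMn : 0 ≤ M := norm_nonneg _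
    have e : 4 * (m * (m + 1)) * M * δ * δ = M * (m / (4 * (m + 1))) := by
      rw [hδdef]
      field_simp
    have e2 : (m : ℝ) / (4 * (m + 1)) ≤ 1 / 4 := by
      rw [div_le_div_iff₀ (by positivity) (by norm_num)]
      linarith
    have e3 := mul_le_mul_of_nonneg_left e2 hMn
    linarith
  exact ⟨δ, hδ, fun z w hz hw => norm_le_zero_iff.1 (hM0 ▸ hle z w hz hw)⟩

theorem SepHol.eq_zero_of_near (hF : SepHol finiteOmega F) {w : ℂ}
    (h0 : ∀ᶠ z in 𝓝 0, F z w = 0) {z : ℂ} (h : z * w ≠ 1) : F z w = 0 := by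
  have ho : IsOpen {s : ℂ | s * w ≠ 1} := isOpen_ne_fun (by fun_prop) (by fun_prop)
  have hd : DifferentiableOn ℂ (fun s => F s w) {s : ℂ | s * w ≠ 1} := fun s hs =>
    (hF.fst s w hs).differentiableWithinAt
  exact (hd.analyticOnNhd ho).eqOn_zero_of_preconnected_of_eventuallyEq_zero
    (isPreconnected_mul_ne_one w) (z₀ := 0) (by simp) h0 h

/-- An eigenfunction is determined by its restrictions to the two axes. -/
theorem IsFiniteEigen.eq_zero (hF : IsFiniteEigen m F) (h1 : ∀ z, F z 0 = 0)
    (h2 : ∀ w, F 0 w = 0) {z w : ℂ} (h : z * w ≠ 1) : F z w = 0 := by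
  obtain ⟨δ, hδ, hz⟩ := hF.eq_zero_near h1 h2
  have hev : ∀ᶠ s : ℂ in 𝓝 0, ‖s‖ ≤ δ := by
    filter_upwards [closedBall_mem_nhds (0 : ℂ) hδ] with s hs
    simpa using hs
  refine hF.flip.hol.eq_zero_of_near (z := w) (w := z) ?_ (by rwa [mul_comm])
  filter_upwards [hev, (isOpen_ne_fun (f := fun t : ℂ => z * t) (g := fun _ => 1) (by fun_prop)
    (by fun_prop)).mem_nhds (show z * 0 ≠ 1 by simp)] with t ht htz
  refine hF.hol.eq_zero_of_near (w := t) ?_ htz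
  filter_upwards [hev] with s hs
  exact hz s t hs ht

/-! ### The invariant bilinear form on polynomials -/

/-- The invariant form `∑ (-1)^k k! (n - k)! A_k A_{n - k}` on polynomials of degree at most `n`, on
the diagonal. -/
noncomputable def invForm (n : ℕ) (A : ℂ[X]) : ℂ :=
  ∑ k ∈ Finset.range (n + 1),
    (-1) ^ k * (k.factorial : ℂ) * ((n - k).factorial : ℂ) * A.coeff k * A.coeff (n - k)

theorem eval_iterate_derivative (A : ℂ[X]) (k : ℕ) (x : ℂ) :
    (derivative^[k] A).eval x = k.factorial * (taylor x A).coeff k := by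
  rw [taylor_coeff, ← factorial_smul_hasseDeriv]
  simp

/-- The form is invariant under translations: the derivative of
`x ↦ ∑ (-1)^k A^{(k)}(x) A^{(n - k)}(x)` telescopes to `0`. -/
theorem invForm_taylor {n : ℕ} {A : ℂ[X]} (hA : A.natDegree ≤ n) (x : ℂ) :
    invForm n (taylor x A) = invForm n A := by
  set T : ℂ[X] := ∑ k ∈ Finset.range (n + 1),
    (-1) ^ k * (derivative^[k] A * derivative^[n - k] A) with hT
  have h0 : derivative^[n + 1] A = 0 := iterate_derivative_eq_zero (by omega)
  have hder : derivative T = 0 := by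
    have e : ∀ k ∈ Finset.range (n + 1),
        derivative ((-1) ^ k * (derivative^[k] A * derivative^[n - k] A)) =
        (-1) ^ k * (derivative^[k] A * derivative^[n + 1 - k] A) -
        (-1) ^ (k + 1) * (derivative^[k + 1] A * derivative^[n + 1 - (k + 1)] A) := by
      intro k hk
      have hk' : k ≤ n := by simpa [Nat.lt_succ_iff] using hk
      have e1 : ((-1 : ℂ[X]) ^ k) = C ((-1) ^ k) := by simp
      rw [pow_succ, e1, derivative_C_mul, derivative_mul, ← Function.iterate_succ_apply' derivative,
        ← Function.iterate_succ_apply' derivative, Nat.succ_sub hk', Nat.succ_sub_succ]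
      simp only [Nat.succ_eq_add_one]
      ring
    rw [hT, derivative_sum, Finset.sum_congr rfl e, Finset.sum_range_sub', h0]
    simp [h0]
  have heval : ∀ y, T.eval y = invForm n (taylor y A) := by
    intro y
    rw [hT, eval_finsetSum, invForm]
    refine Finset.sum_congr rfl fun k _ => ?_
    rw [eval_mul, eval_mul, eval_iterate_derivative, eval_iterate_derivative]
    simp
    ring
  have hc := eq_C_of_derivative_eq_zero hder
  have h1 := heval x
  have h2 := heval 0
  rw [hc, eval_C] at h1 h2
  rw [← h1, h2, taylor_zero]

/-- The polynomial whose coefficients are, up to sign and a common factor, the Poisson modes in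
homogeneous coordinates. -/
noncomputable def modePoly (m : ℕ) (a b c d : ℂ) : ℂ[X] :=
  (C b + C a * X) ^ m * (C c + C d * X) ^ m

theorem coeff_linear_pow (m : ℕ) (a b : ℂ) (k : ℕ) :
    ((C b + C a * X) ^ m).coeff k = m.choose k * a ^ k * b ^ (m - k) := by
  rw [add_comm, add_pow, finsetSum_coeff]
  simp only [mul_pow, ← C_pow, ← C_eq_natCast, mul_assoc, coeff_C_mul, coeff_X_pow_mul', ← C_mul,
    coeff_C]
  rw [Finset.sum_eq_single k]
  · simp
    ring
  · intro j _ hj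
    by_cases h : j ≤ k
    · rw [if_pos h, if_neg (by omega), mul_zero]
    · rw [if_neg h, mul_zero]
  · intro hk
    have : m < k := by simpa using hk
    simp [Nat.choose_eq_zero_of_lt this]

theorem natDegree_linear_pow_le (m : ℕ) (a b : ℂ) : ((C b + C a * X) ^ m).natDegree ≤ m := by
  refine natDegree_le_iff_coeff_eq_zero.2 fun k hk => ?_
  rw [coeff_linear_pow, Nat.choose_eq_zero_of_lt hk]
  simp

theorem natDegree_modePoly_le (m : ℕ) (a b c d : ℂ) :
    (modePoly m a b c d).natDegree ≤ 2 * m := by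
  rw [two_mul]
  exact natDegree_mul_le_of_le (natDegree_linear_pow_le m a b) (natDegree_linear_pow_le m d c)

/-- The form is evaluated by translating a root of one of the two factors to the origin, so that a
single term is left. -/
theorem invForm_modePoly (m : ℕ) (a b c d : ℂ) :
    invForm (2 * m) (modePoly m a b c d) =
      (-1) ^ m * (m.factorial : ℂ) ^ 2 * (b * d - a * c) ^ (2 * m) := by
  have hlow : ∀ k < m, ∀ a' d' e : ℂ, ((C a' * X) ^ m * (C e + C d' * X) ^ m).coeff k = 0 := by
    intro k hk a' d' e
    rw [mul_pow, ← C_pow, mul_assoc, coeff_C_mul, coeff_X_pow_mul', if_neg (by omega), mul_zero]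
  have hmid : ∀ a' d' e : ℂ, ((C a' * X) ^ m * (C e + C d' * X) ^ m).coeff m = (a' * e) ^ m := by
    intro a' d' e
    rw [mul_pow, ← C_pow, mul_assoc, coeff_C_mul, coeff_X_pow_mul', if_pos le_rfl,
      coeff_linear_pow]
    simp [mul_pow]
  -- if the coefficients on one side of the middle vanish, only the middle term of the form survives
  have single : ∀ A : ℂ[X], ((∀ k < m, A.coeff k = 0) ∨ ∀ k, m < k → A.coeff k = 0) →
      invForm (2 * m) A = (-1) ^ m * (m.factorial : ℂ) ^ 2 * A.coeff m ^ 2 := by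
    intro A hA
    rw [invForm, Finset.sum_eq_single m]
    · rw [show 2 * m - m = m by omega]
      ring
    · intro k hk hkm
      have hk' : k < 2 * m + 1 := Finset.mem_range.1 hk
      rcases hA with hA | hA <;> rcases lt_or_gt_of_ne hkm with h | h
      · simp [hA k h]
      · simp [hA (2 * m - k) (by omega)]
      · simp [hA (2 * m - k) (by omega)]
      · simp [hA k h]
    · intro h
      exact absurd (Finset.mem_range.2 (by omega)) h
  by_cases ha : a = 0
  · have e : modePoly m a b c d = C (b ^ m) * (C c + C d * X) ^ m := by simp [modePoly, ha]
    rw [e, single _ (Or.inr fun k hk => by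
      rw [coeff_C_mul, coeff_linear_pow, Nat.choose_eq_zero_of_lt hk]; simp)]
    rw [coeff_C_mul, coeff_linear_pow, ha]
    simp only [Nat.choose_self, Nat.cast_one, one_mul, Nat.sub_self, pow_zero, mul_one, zero_mul,
      sub_zero]
    ring
  · rw [← invForm_taylor (natDegree_modePoly_le m a b c d) (-b / a)]
    have e : taylor (-b / a) (modePoly m a b c d) =
        (C a * X) ^ m * (C (c + d * (-b / a)) + C d * X) ^ m := by
      simp only [modePoly, taylor_mul, taylor_pow, map_add, taylor_C, taylor_X]
      congr 2
      · rw [mul_add, ← C_mul, mul_div_cancel₀ _ ha, C_neg]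
        ring
      · rw [mul_add, C_mul]
        ring
    rw [e, single _ (Or.inl fun k hk => hlow k hk _ _ _), hmid]
    have e2 : a * (c + d * (-b / a)) = -(b * d - a * c) := by
      field_simp
      ring
    rw [e2, ← pow_mul, mul_comm m 2, Even.neg_pow (even_two_mul m)]

theorem modePoly_comm (m : ℕ) (a b c d : ℂ) : modePoly m a b c d = modePoly m d c b a := by
  rw [modePoly, modePoly, mul_comm]

theorem reflect_linear_pow (m : ℕ) (a b : ℂ) :
    reflect m ((C b + C a * X) ^ m) = (C a + C b * X) ^ m := by
  ext k
  rw [coeff_reflect, coeff_linear_pow, coeff_linear_pow]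
  by_cases hk : k ≤ m
  · rw [revAt_le hk, Nat.choose_symm hk, Nat.sub_sub_self hk]
    ring
  · rw [revAt_eq_self_of_lt (not_le.1 hk), Nat.choose_eq_zero_of_lt (not_le.1 hk)]
    simp

/-- Reversal of the coefficients amounts to exchanging the two homogeneous coordinates. -/
theorem coeff_modePoly_reverse (m : ℕ) (a b c d : ℂ) {k : ℕ} (hk : k ≤ 2 * m) :
    (modePoly m a b c d).coeff k = (modePoly m c d a b).coeff (2 * m - k) := by
  have h := reflect_mul _ _ (natDegree_linear_pow_le m a b) (natDegree_linear_pow_le m d c)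
  rw [reflect_linear_pow, reflect_linear_pow, ← two_mul] at h
  have h1 : modePoly m c d a b = reflect (2 * m) (modePoly m a b c d) := by
    rw [modePoly, modePoly, h, mul_comm]
  rw [h1, coeff_reflect, revAt_le (Nat.sub_le _ _), Nat.sub_sub_self hk]

theorem coeff_modePoly_neg (m : ℕ) (a b c d : ℂ) (k : ℕ) :
    (modePoly m (-a) b c (-d)).coeff k = (-1) ^ k * (modePoly m a b c d).coeff k := by
  have h : modePoly m (-a) b c (-d) = (modePoly m a b c d).comp (C (-1) * X) := by
    simp [modePoly]
  rw [h, comp_C_mul_X_coeff, mul_comm]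

theorem coeff_modePoly_lower {m N : ℕ} (hN : N ≤ m) (a b c d : ℂ) :
    (modePoly m a b c d).coeff (m - N) =
      (∑ k ∈ Finset.range (m - N + 1), (m.choose (k + N) : ℂ) * (m.choose k : ℂ) * (a * c) ^ k *
        (b * d) ^ (m - N - k)) * (b * c) ^ N := by
  rw [modePoly, coeff_mul, Finset.Nat.sum_antidiagonal_eq_sum_range_succ_mk, Finset.sum_mul]
  refine Finset.sum_congr rfl fun k hk => ?_
  have hk' : k ≤ m - N := by simpa [Nat.lt_succ_iff] using hk
  rw [coeff_linear_pow, coeff_linear_pow]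
  have e1 : m - N - k = m - (k + N) := by omega
  have e2 : m - k = (m - N - k) + N := by omega
  have e3 : m - (m - N - k) = k + N := by omega
  rw [e3, e2, e1, Nat.choose_symm (by omega : k + N ≤ m)]
  ring

theorem homMode_neg (m N : ℕ) (a b c d : ℂ) :
    homMode m (-(N : ℤ)) a b c d = homMode m N c d a b := by
  rcases Nat.eq_zero_or_pos N with rfl | hN
  · simp [homMode, mul_comm]
  · simp only [homMode, Int.natAbs_neg, Int.natAbs_natCast, Int.natCast_nonneg, if_true]
    rw [if_neg (by omega), mul_comm c a, mul_comm d b, mul_comm d a]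

theorem homMode_eq_coeff {m k : ℕ} (hk : k ≤ 2 * m) (a b c d : ℂ) :
    homMode m ((m : ℤ) - k) a b c d =
      (-1) ^ (m + k) * (modePoly m a b c d).coeff k * ((b * d - a * c) ^ m)⁻¹ := by
  have pos : ∀ N ≤ m, ∀ a b c d : ℂ, homMode m (N : ℤ) a b c d =
      (-1) ^ N * (modePoly m a b c d).coeff (m - N) * ((b * d - a * c) ^ m)⁻¹ := by
    intro N hN a b c d
    rw [coeff_modePoly_lower hN]
    simp only [homMode, Int.natAbs_natCast, Int.natCast_nonneg, if_true]
    ring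
  rcases le_total k m with h | h
  · obtain ⟨N, rfl⟩ := Nat.exists_eq_add_of_le h
    rw [show (((k + N : ℕ) : ℤ) - k) = (N : ℤ) by push_cast; ring, pos N (by omega),
      Nat.add_sub_cancel]
    congr 2
    rw [show k + N + k = 2 * k + N by ring, pow_add, pow_mul]
    simp
  · obtain ⟨N, rfl⟩ := Nat.exists_eq_add_of_le h
    rw [show ((m : ℤ) - (m + N : ℕ)) = -(N : ℤ) by push_cast; ring, homMode_neg,
      pos N (by omega), coeff_modePoly_reverse m a b c d hk,
      show 2 * m - (m + N) = m - N by omega, mul_comm d b, mul_comm c a]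
    congr 2
    rw [← add_assoc, ← two_mul, pow_add, pow_mul]
    simp

/-! ### The zonal harmonic in terms of the modes -/

theorem exists_homogeneous_coords (p : Omega) : ∃ a b c d : ℂ, b * d - a * c ≠ 0 ∧
    ∀ m n, poissonMode m n p = homMode m n a b c d := by
  obtain ⟨⟨x, y⟩, h⟩ := p
  induction x using OnePoint.rec <;> induction y using OnePoint.rec
  · exact ⟨1, 0, 1, 0, by simp, fun m n => poissonMode_infty_infty m n h⟩
  · rename_i w
    refine ⟨1, 0, w, 1, ?_, fun m n => poissonMode_infty_coe m n w h⟩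
    rintro h0
    obtain rfl : w = 0 := by simpa using h0
    simp [Omega, sphereMul] at h
  · rename_i z
    refine ⟨z, 1, 1, 0, ?_, fun m n => poissonMode_coe_infty m n z h⟩
    rintro h0
    obtain rfl : z = 0 := by simpa using h0
    simp [Omega, sphereMul] at h
  · rename_i z w
    refine ⟨z, 1, w, 1, ?_, fun m n => poissonMode_coe m n z w h⟩
    rw [mul_one]
    exact sub_ne_zero.2 (Ne.symm (coe_mem_Omega.1 h))

/-- The modes, indexed by `k = m - j ∈ {0, …, 2 m}` and without the sign: this is the coefficient of
`s ^ k` in `((1 + z s) (w + s) / (1 - z w)) ^ m`. -/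
noncomputable def coeffMode (m k : ℕ) (p : Omega) : ℂ :=
  (-1) ^ (m + k) * poissonMode m ((m : ℤ) - k) p

theorem neg_one_pow_mul_self (n : ℕ) : ((-1 : ℂ) ^ n) * (-1) ^ n = 1 := by
  rw [← mul_pow]; simp

theorem neg_one_pow_reverse {m k : ℕ} (hk : k ≤ 2 * m) :
    ((-1 : ℂ)) ^ (m + (2 * m - k)) = (-1) ^ (m + k) := by
  rw [neg_one_pow_congr]
  simp only [Nat.even_add, Nat.even_sub hk, even_two_mul, true_iff]

theorem coeffMode_eq {m k : ℕ} (hk : k ≤ 2 * m) {p : Omega} {a b c d : ℂ}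
    (h : ∀ m n, poissonMode m n p = homMode m n a b c d) :
    coeffMode m k p = (modePoly m a b c d).coeff k * ((b * d - a * c) ^ m)⁻¹ := by
  rw [coeffMode, h, homMode_eq_coeff hk]
  linear_combination ((modePoly m a b c d).coeff k * ((b * d - a * c) ^ m)⁻¹) *
    neg_one_pow_mul_self (m + k)

theorem choose_neg_succ (m N : ℕ) :
    ((Ring.choose (-(m : ℤ) - 1) N : ℤ) : ℂ) = (-1) ^ N * ((m + N).choose N : ℂ) := by
  rw [show (-(m : ℤ) - 1) = -((m + 1 : ℕ) : ℤ) by push_cast; ring, Ring.choose_neg,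
    show ((m + 1 : ℕ) : ℤ) + N - 1 = ((m + N : ℕ) : ℤ) by push_cast; ring, Ring.choose_natCast]
  rw [Int.negOnePow_def, Units.smul_def]
  simp

/-- The square roots in the normalization occur twice, and
`binom(m, N)⁻¹ binom(-m-1, N) = (-1)^N (m + N)! (m - N)! / m!²`. -/
theorem normalizedMode_mul {m k : ℕ} (hk : k ≤ 2 * m) (p q : Omega) :
    normalizedMode m ((m : ℤ) - k) p * normalizedMode m (-((m : ℤ) - k)) q =
      (2 * m + 1) / (m.factorial : ℂ) ^ 2 * ((-1) ^ (m + k) * (k.factorial : ℂ) *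
        ((2 * m - k).factorial : ℂ) * coeffMode m k p * coeffMode m (2 * m - k) q) := by
  set N := ((m : ℤ) - k).natAbs with hN
  have hNm : N ≤ m := by omega
  have hsign : ((-1 : ℂ)) ^ N = (-1) ^ (m + k) := by
    rcases le_total k m with h | h
    · rw [show m + k = N + 2 * k by omega, pow_add, pow_mul]; simp
    · rw [show m + k = N + 2 * m by omega, pow_add, pow_mul]; simp
  have hfact : (k.factorial : ℂ) * ((2 * m - k).factorial : ℂ) =
      ((m + N).factorial : ℂ) * ((m - N).factorial : ℂ) := by
    rcases le_total k m with h | h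
    · rw [show k = m - N by omega, show 2 * m - (m - N) = m + N by omega, mul_comm]
    · rw [show k = m + N by omega, show 2 * m - (m + N) = m - N by omega]
  have hc : (m.choose N : ℂ) ≠ 0 := by exact_mod_cast (Nat.choose_pos hNm).ne'
  have hfm : (m.factorial : ℂ) ≠ 0 := by exact_mod_cast m.factorial_ne_zero
  have hfN : (N.factorial : ℂ) ≠ 0 := by exact_mod_cast N.factorial_ne_zero
  have e1 : (m.choose N : ℂ) * N.factorial * (m - N).factorial = m.factorial := by
    exact_mod_cast Nat.choose_mul_factorial_mul_factorial hNm
  have e2 : ((m + N).choose N : ℂ) * m.factorial * N.factorial = (m + N).factorial := by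
    exact_mod_cast Nat.add_choose_mul_factorial_mul_factorial m N
  have s1 : (Real.sqrt (2 * m + 1) : ℂ) * (Real.sqrt (2 * m + 1) : ℂ) = 2 * m + 1 := by
    rw [← Complex.ofReal_mul, Real.mul_self_sqrt (by positivity)]
    push_cast
    rfl
  have s2 : (m.choose N : ℂ) ^ (-(1 / 2) : ℂ) * (m.choose N : ℂ) ^ (-(1 / 2) : ℂ) =
      (m.choose N : ℂ)⁻¹ := by
    rw [← Complex.cpow_add _ _ hc, ← Complex.cpow_neg_one]
    norm_num
  have hr : (((Ring.choose (-(m : ℤ) - 1) N : ℤ) : ℂ)) ≠ 0 := by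
    rw [choose_neg_succ]
    refine mul_ne_zero (pow_ne_zero _ (by norm_num)) ?_
    exact_mod_cast (Nat.choose_pos (Nat.le_add_left N m)).ne'
  have s3 : ((Ring.choose (-(m : ℤ) - 1) N : ℤ) : ℂ) ^ (1 / 2 : ℂ) *
      ((Ring.choose (-(m : ℤ) - 1) N : ℤ) : ℂ) ^ (1 / 2 : ℂ) =
      (-1) ^ N * ((m + N).choose N : ℂ) := by
    rw [← Complex.cpow_add _ _ hr, ← choose_neg_succ]
    norm_num
  have p1 : coeffMode m k p * coeffMode m (2 * m - k) q =
      poissonMode m ((m : ℤ) - k) p * poissonMode m (-((m : ℤ) - k)) q := by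
    rw [coeffMode, coeffMode, show ((m : ℤ) - ((2 * m - k : ℕ) : ℤ)) = -((m : ℤ) - k) by omega,
      neg_one_pow_reverse hk]
    linear_combination (poissonMode m ((m : ℤ) - k) p * poissonMode m (-((m : ℤ) - k)) q) *
      neg_one_pow_mul_self (m + k)
  have p2 : ((m + N).choose N : ℂ) * (m.choose N : ℂ)⁻¹ =
      (m + N).factorial * (m - N).factorial / (m.factorial : ℂ) ^ 2 := by
    field_simp
    rw [← e2]
    linear_combination (((m + N).choose N : ℂ) * m.factorial) * (-e1)
  rw [normalizedMode, normalizedMode, Int.natAbs_neg, ← hN]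
  calc _ = ((Real.sqrt (2 * m + 1) : ℂ) * (Real.sqrt (2 * m + 1) : ℂ)) *
        ((m.choose N : ℂ) ^ (-(1 / 2) : ℂ) * (m.choose N : ℂ) ^ (-(1 / 2) : ℂ)) *
        (((Ring.choose (-(m : ℤ) - 1) N : ℤ) : ℂ) ^ (1 / 2 : ℂ) *
          ((Ring.choose (-(m : ℤ) - 1) N : ℤ) : ℂ) ^ (1 / 2 : ℂ)) *
        (poissonMode m ((m : ℤ) - k) p * poissonMode m (-((m : ℤ) - k)) q) := by ring
    _ = (2 * m + 1) * (-1) ^ N * (((m + N).choose N : ℂ) * (m.choose N : ℂ)⁻¹) *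
        (poissonMode m ((m : ℤ) - k) p * poissonMode m (-((m : ℤ) - k)) q) := by
      rw [s1, s2, s3]; ring
    _ = _ := by
      rw [p2, ← hfact, ← p1, hsign]; ring

theorem zonal_eq (m : ℕ) (p q : Omega) : zonal m p q =
    (2 * m + 1) / (m.factorial : ℂ) ^ 2 * ∑ k ∈ Finset.range (2 * m + 1),
      ((-1) ^ (m + k) * (k.factorial : ℂ) * ((2 * m - k).factorial : ℂ) *
        coeffMode m k p * coeffMode m (2 * m - k) q) := by
  rw [zonal, Finset.mul_sum]
  refine Finset.sum_nbij' (fun j => ((m : ℤ) - j).toNat) (fun k => (m : ℤ) - k) ?_ ?_ ?_ ?_ ?_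
  · intro j hj
    rw [Finset.mem_Icc] at hj
    rw [Finset.mem_range]
    omega
  · intro k hk
    rw [Finset.mem_range] at hk
    rw [Finset.mem_Icc]
    omega
  · intro j hj
    rw [Finset.mem_Icc] at hj
    omega
  · intro k hk
    omega
  · intro j hj
    rw [Finset.mem_Icc] at hj
    obtain ⟨k, hk⟩ : ∃ k : ℕ, (m : ℤ) - j = k := ⟨((m : ℤ) - j).toNat, by omega⟩
    obtain rfl : j = (m : ℤ) - k := by omega
    rw [normalizedMode_mul (by omega) p q]
    simp

theorem zonal_symm (m : ℕ) (p q : Omega) : zonal m p q = zonal m q p := by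
  rw [zonal_eq, zonal_eq, ← Finset.sum_flip]
  congr 1
  refine Finset.sum_congr rfl fun k hk => ?_
  have hk' : k ≤ 2 * m := by simpa [Nat.lt_succ_iff] using hk
  rw [Nat.sub_sub_self hk']
  rw [neg_one_pow_reverse hk']
  ring

theorem zonal_self (m : ℕ) (p : Omega) : zonal m p p = 2 * (m : ℂ) + 1 := by
  obtain ⟨a, b, c, d, h0, h⟩ := exists_homogeneous_coords p
  have hfm : (m.factorial : ℂ) ≠ 0 := by exact_mod_cast m.factorial_ne_zero
  have e : ∑ k ∈ Finset.range (2 * m + 1),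
      ((-1) ^ (m + k) * (k.factorial : ℂ) * ((2 * m - k).factorial : ℂ) *
        coeffMode m k p * coeffMode m (2 * m - k) p) =
      (-1) ^ m * ((b * d - a * c) ^ (2 * m))⁻¹ * invForm (2 * m) (modePoly m a b c d) := by
    rw [invForm, Finset.mul_sum]
    refine Finset.sum_congr rfl fun k hk => ?_
    have hk' : k ≤ 2 * m := by simpa [Nat.lt_succ_iff] using hk
    rw [coeffMode_eq hk' h, coeffMode_eq (Nat.sub_le _ _) h, two_mul m, pow_add (b * d - a * c),
      mul_inv]
    ring
  rw [zonal_eq, e, invForm_modePoly]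
  have h1 : (b * d - a * c) ^ (2 * m) ≠ 0 := pow_ne_zero _ h0
  field_simp
  linear_combination (2 * (m : ℂ) + 1) * neg_one_pow_mul_self m

/-! ### The eigenspace is spanned by the modes -/

theorem pull_congr (F : Omega → ℂ) {i j i' j' : Bool} {x y x' y' : ℂ}
    (h1 : chart i x = chart i' x') (h2 : chart j y = chart j' y') :
    pull F i j x y = pull F i' j' x' y' := by
  unfold pull
  revert h1 h2
  generalize chart i x = P
  generalize chart j y = Q
  rintro rfl rfl
  rfl

theorem isOpen_chart_mem_Omega (i j : Bool) :
    IsOpen {q : ℂ × ℂ | (chart i q.1, chart j q.2) ∈ Omega} := by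
  simp only [chart_mem_Omega]
  have h1 : ∀ i, Continuous (num i) := fun i => by unfold num; split_ifs <;> fun_prop
  have h2 : ∀ i, Continuous (den i) := fun i => by unfold den; split_ifs <;> fun_prop
  have h3 := h1 i
  have h4 := h2 i
  have h5 := h1 j
  have h6 := h2 j
  exact isOpen_ne_fun (by fun_prop) (by fun_prop)

theorem finiteOmega_eq :
    {q : ℂ × ℂ | (chart false q.1, chart false q.2) ∈ Omega} = finiteOmega := by
  ext q
  exact coe_mem_Omega

theorem pull_finite (F : Omega → ℂ) {z w : ℂ} (h : z * w ≠ 1) :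
    pull F false false z w = F ⟨((z : OnePoint ℂ), (w : OnePoint ℂ)), coe_mem_Omega.2 h⟩ :=
  dif_pos _

theorem IsHolomorphic.sepHol {F : Omega → ℂ} (hF : IsHolomorphic F) :
    SepHol finiteOmega (pull F false false) :=
  SepHol.of_differentiableOn isOpen_finiteOmega (finiteOmega_eq ▸ hF false false)

theorem pull_sum {ι : Type*} (s : Finset ι) (c : ι → ℂ) (g : ι → Omega → ℂ) (i j : Bool)
    (x y : ℂ) : pull (fun p => ∑ k ∈ s, c k * g k p) i j x y = ∑ k ∈ s, c k * pull (g k) i j x y := by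
  by_cases h : (chart i x, chart j y) ∈ Omega
  · simp [pull, dif_pos h]
  · simp [pull, dif_neg h]

theorem IsHolomorphic.sum {ι : Type*} (s : Finset ι) (c : ι → ℂ) {g : ι → Omega → ℂ}
    (hg : ∀ k ∈ s, IsHolomorphic (g k)) : IsHolomorphic (fun p => ∑ k ∈ s, c k * g k p) := by
  intro i j
  simp only [pull_sum]
  exact DifferentiableOn.fun_sum fun k hk => (hg k hk i j).const_mul _

theorem isHolomorphic_coeffMode (m k : ℕ) : IsHolomorphic (coeffMode m k) := by
  have := IsHolomorphic.sum {()} (fun _ => (-1) ^ (m + k))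
    (g := fun _ : Unit => poissonMode m ((m : ℤ) - k)) (fun _ _ => isHolomorphic_poissonMode _ _)
  simp only [Finset.sum_singleton] at this
  exact this

/-- Every point of the sphere is the value of a chart at the center of a punctured neighbourhood that
parametrizes finite points. -/
theorem exists_chart (P : OnePoint ℂ) :
    ∃ i x, chart i x = P ∧ ∀ ε : ℂ, ε ≠ 0 → ∃ z : ℂ, chart i (x + ε) = (z : OnePoint ℂ) := by
  induction P using OnePoint.rec
  · exact ⟨true, 0, by simp [chart], fun ε hε => ⟨ε⁻¹, by simp [chart, hε]⟩⟩
  · rename_i z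
    exact ⟨false, z, rfl, fun ε _ => ⟨z + ε, rfl⟩⟩

/-- A holomorphic function on `Ω` is determined by its values at the finite points. -/
theorem IsHolomorphic.ext {f g : Omega → ℂ} (hf : IsHolomorphic f) (hg : IsHolomorphic g)
    (h : ∀ z w, z * w ≠ 1 → pull f false false z w = pull g false false z w) (p : Omega) :
    f p = g p := by
  obtain ⟨⟨P, Q⟩, hp⟩ := p
  obtain ⟨i, x, rfl, hx⟩ := exists_chart P
  obtain ⟨j, y, rfl, hy⟩ := exists_chart Q
  have hval : ∀ F : Omega → ℂ, F ⟨(chart i x, chart j y), hp⟩ = pull F i j x y :=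
    fun F => by rw [pull, dif_pos hp]
  rw [hval f, hval g]
  have ho := isOpen_chart_mem_Omega i j
  have hlin : Tendsto (fun ε : ℂ => (x + ε, y + ε)) (𝓝[≠] 0) (𝓝 (x, y)) := by
    have : Tendsto (fun ε : ℂ => (x + ε, y + ε)) (𝓝 0) (𝓝 (x + 0, y + 0)) :=
      Continuous.tendsto (by fun_prop) 0
    simp only [add_zero] at this
    exact this.mono_left nhdsWithin_le_nhds
  have hlim : ∀ F : Omega → ℂ, IsHolomorphic F →
      Tendsto (fun ε : ℂ => pull F i j (x + ε) (y + ε)) (𝓝[≠] 0) (𝓝 (pull F i j x y)) :=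
    fun F hF => (((hF i j).differentiableAt (ho.mem_nhds hp)).continuousAt.tendsto).comp hlin
  refine tendsto_nhds_unique ((hlim f hf).congr' ?_) (hlim g hg)
  filter_upwards [hlin.eventually (ho.mem_nhds hp), self_mem_nhdsWithin] with ε hε hε0
  obtain ⟨z, hz⟩ := hx ε hε0
  obtain ⟨w, hw⟩ := hy ε hε0
  have hzw : z * w ≠ 1 := by
    rw [← coe_mem_Omega, ← hz, ← hw]
    exact hε
  rw [pull_congr f (i' := false) (j' := false) hz hw,
    pull_congr g (i' := false) (j' := false) hz hw]
  exact h z w hzw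

theorem SepHol.derivFst_derivSnd_sum {U : Set (ℂ × ℂ)} (hU : IsOpen U) {ι : Type*} (s : Finset ι)
    (c : ι → ℂ) {G : ι → ℂ → ℂ → ℂ} (hG : ∀ k ∈ s, SepHol U (G k)) {z w : ℂ} (h : (z, w) ∈ U) :
    derivFst (derivSnd fun z w => ∑ k ∈ s, c k * G k z w) z w =
      ∑ k ∈ s, c k * derivFst (derivSnd (G k)) z w := by
  have ho : IsOpen {s : ℂ | (s, w) ∈ U} := hU.preimage (by fun_prop)
  have h1 : (fun a => derivSnd (fun z w => ∑ k ∈ s, c k * G k z w) a w) =ᶠ[𝓝 z]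
      fun a => ∑ k ∈ s, c k * derivSnd (G k) a w := by
    filter_upwards [ho.mem_nhds h] with a ha
    exact (HasDerivAt.fun_sum fun k hk => ((hG k hk).hasDerivAt_snd ha).const_mul (c k)).deriv
  exact (EventuallyEq.deriv_eq h1).trans (HasDerivAt.fun_sum fun k hk =>
    (((hG k hk).partialSnd hU).hasDerivAt_fst h).const_mul (c k)).deriv

theorem IsFiniteEigen.sum {m : ℕ} {ι : Type*} (s : Finset ι) (c : ι → ℂ) {G : ι → ℂ → ℂ → ℂ}
    (hG : ∀ k ∈ s, IsFiniteEigen m (G k))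
    (hs : SepHol finiteOmega fun z w => ∑ k ∈ s, c k * G k z w) :
    IsFiniteEigen m (fun z w => ∑ k ∈ s, c k * G k z w) := by
  refine ⟨hs, fun z w hzw => ?_⟩
  rw [SepHol.derivFst_derivSnd_sum isOpen_finiteOmega s c (fun k hk => (hG k hk).hol) hzw,
    Finset.mul_sum, Finset.mul_sum]
  refine Finset.sum_congr rfl fun k hk => ?_
  linear_combination c k * (hG k hk).eqn z w hzw

theorem coeff_eq_of_sum_pow_eq {n : ℕ} {a b : ℕ → ℂ}
    (h : ∀ s : ℂ, ∑ k ∈ Finset.range n, s ^ k * a k = ∑ k ∈ Finset.range n, s ^ k * b k)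
    {k : ℕ} (hk : k < n) : a k = b k := by
  have h1 : ∑ k ∈ Finset.range n, C (a k) * X ^ k = ∑ k ∈ Finset.range n, C (b k) * X ^ k := by
    refine Polynomial.funext fun s => ?_
    simp only [eval_finsetSum, eval_mul, eval_C, eval_pow, eval_X]
    simpa only [mul_comm] using h s
  have h2 := congrArg (fun p => p.coeff k) h1
  simpa [finsetSum_coeff, coeff_X_pow, hk] using h2

/-- The generating function `((1 + z s) (w + s) / (1 - z w)) ^ m` of the modes. -/
noncomputable def genMode (m : ℕ) (s z w : ℂ) : ℂ := ((1 + z * s) * (w + s) / (1 - z * w)) ^ m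

theorem pull_coeffMode {m k : ℕ} (hk : k ≤ 2 * m) {z w : ℂ} (h : z * w ≠ 1) :
    pull (coeffMode m k) false false z w =
      (modePoly m z 1 w 1).coeff k * ((1 - z * w) ^ m)⁻¹ := by
  rw [pull_finite _ h, coeffMode_eq hk fun m n => poissonMode_coe m n z w (coe_mem_Omega.2 h)]
  simp

theorem sum_pow_mul_coeff_modePoly (m : ℕ) (a b c d s : ℂ) :
    ∑ k ∈ Finset.range (2 * m + 1), s ^ k * (modePoly m a b c d).coeff k =
      ((b + a * s) * (c + d * s)) ^ m := by
  have h := eval_eq_sum_range' (Nat.lt_succ_of_le (natDegree_modePoly_le m a b c d)) s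
  simp only [modePoly, eval_mul, eval_pow, eval_add, eval_C, eval_X] at h
  rw [mul_pow, h]
  exact Finset.sum_congr rfl fun k _ => mul_comm _ _

theorem sum_pow_mul_coeffMode (m : ℕ) (s : ℂ) {z w : ℂ} (h : z * w ≠ 1) :
    ∑ k ∈ Finset.range (2 * m + 1), s ^ k * pull (coeffMode m k) false false z w =
      genMode m s z w := by
  have e : ∀ k ∈ Finset.range (2 * m + 1), s ^ k * pull (coeffMode m k) false false z w =
      s ^ k * (modePoly m z 1 w 1).coeff k * ((1 - z * w) ^ m)⁻¹ := by
    intro k hk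
    rw [pull_coeffMode (by simpa [Nat.lt_succ_iff] using hk) h, mul_assoc]
  rw [Finset.sum_congr rfl e, ← Finset.sum_mul, sum_pow_mul_coeff_modePoly, genMode, div_pow,
    one_mul, div_eq_mul_inv]

/-- With `u = (1 + z s) (w + s) / (1 - z w)` and `v = (1 + z s) / (1 - z w)` one has `∂_w u = v²`,
`(1 - z w)² ∂_z u = (w + s)²` and `(1 - z w)² ∂_z v = w + s`. -/
theorem genMode_eqn (m : ℕ) (s : ℂ) {z w : ℂ} (h : z * w ≠ 1) :
    (1 - z * w) ^ 2 * derivFst (derivSnd (genMode m s)) z w = m * (m + 1) * genMode m s z w := by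
  rcases m with _ | m
  · have h1 : derivSnd (genMode 0 s) = fun _ _ => 0 := by
      funext z w
      simp [derivSnd, genMode]
    have h2 : derivFst (fun _ _ => 0) z w = 0 := by simp [derivFst]
    rw [h1, h2]
    simp
  have hne : ∀ {a b : ℂ}, a * b ≠ 1 → 1 - a * b ≠ 0 := fun h => sub_ne_zero.2 (Ne.symm h)
  have hsnd : ∀ a b : ℂ, a * b ≠ 1 → derivSnd (genMode (m + 1) s) a b =
      (m + 1) * ((1 + a * s) * (b + s) / (1 - a * b)) ^ m * ((1 + a * s) / (1 - a * b)) ^ 2 := by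
    intro a b hab
    have h0 := hne hab
    have hC : HasDerivAt (fun t => 1 - a * t) (-a) b := by
      simpa using ((hasDerivAt_id b).const_mul a).const_sub 1
    have hd := ((((hasDerivAt_id b).add_const s).const_mul (1 + a * s)).div hC h0).pow (m + 1)
    refine hd.deriv.trans ?_
    simp only [Pi.div_apply, id, Nat.add_sub_cancel]
    push_cast
    field_simp
    ring
  have ho : IsOpen {a : ℂ | a * w ≠ 1} := isOpen_ne_fun (by fun_prop) (by fun_prop)
  have h1 : (fun a => derivSnd (genMode (m + 1) s) a w) =ᶠ[𝓝 z] fun a =>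
      (m + 1) * ((1 + a * s) * (w + s) / (1 - a * w)) ^ m * ((1 + a * s) / (1 - a * w)) ^ 2 := by
    filter_upwards [ho.mem_nhds h] with a ha
    exact hsnd a w ha
  have h0 := hne h
  have hC : HasDerivAt (fun a => 1 - a * w) (-w) z := by
    simpa using ((hasDerivAt_id z).mul_const w).const_sub 1
  have hA : HasDerivAt (fun a => 1 + a * s) s z := by
    simpa using ((hasDerivAt_id z).mul_const s).const_add 1
  have hd := ((((hA.mul_const (w + s)).div hC h0).pow m).const_mul ((m : ℂ) + 1)).mul
    ((hA.div hC h0).pow 2)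
  have h2 : derivFst (derivSnd (genMode (m + 1) s)) z w = _ :=
    (EventuallyEq.deriv_eq h1).trans hd.deriv
  rw [h2, genMode]
  simp only [Pi.div_apply, Pi.pow_apply]
  rw [show s * (w + s) * (1 - z * w) - (1 + z * s) * (w + s) * -w = (w + s) ^ 2 by ring,
    show s * (1 - z * w) - (1 + z * s) * -w = w + s by ring]
  rcases m with _ | m
  · simp
    field_simp
    ring
  · simp only [Nat.add_sub_cancel, div_pow, mul_pow]
    push_cast
    field_simp
    ring

theorem isFiniteEigen_coeffMode {m k : ℕ} (hk : k ≤ 2 * m) :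
    IsFiniteEigen m (pull (coeffMode m k) false false) := by
  refine ⟨(isHolomorphic_coeffMode m k).sepHol, fun z w hzw => ?_⟩
  -- the equation holds for the generating function, hence for its coefficients
  refine coeff_eq_of_sum_pow_eq (n := 2 * m + 1)
    (a := fun k => (1 - z * w) ^ 2 * derivFst (derivSnd (pull (coeffMode m k) false false)) z w)
    (b := fun k => m * (m + 1) * pull (coeffMode m k) false false z w) (fun s => ?_)
    (Nat.lt_succ_of_le hk)
  have ho : IsOpen {a : ℂ | a * w ≠ 1} := isOpen_ne_fun (by fun_prop) (by fun_prop)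
  have hlocal : derivFst (derivSnd fun z w => ∑ k ∈ Finset.range (2 * m + 1),
      s ^ k * pull (coeffMode m k) false false z w) z w =
      derivFst (derivSnd (genMode m s)) z w := by
    refine EventuallyEq.deriv_eq ?_
    filter_upwards [ho.mem_nhds hzw] with a ha
    refine EventuallyEq.deriv_eq ?_
    have ho' : IsOpen {t : ℂ | a * t ≠ 1} := isOpen_ne_fun (by fun_prop) (by fun_prop)
    filter_upwards [ho'.mem_nhds ha] with t ht
    exact sum_pow_mul_coeffMode m s ht
  rw [SepHol.derivFst_derivSnd_sum isOpen_finiteOmega _ _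
    (fun k _ => (isHolomorphic_coeffMode m k).sepHol) hzw] at hlocal
  have h1 := genMode_eqn m s hzw
  rw [← hlocal, ← sum_pow_mul_coeffMode m s hzw, Finset.mul_sum, Finset.mul_sum] at h1
  refine Eq.trans ?_ (h1.trans ?_) <;> exact Finset.sum_congr rfl fun k _ => by ring

theorem isFiniteEigen_of_mem_eigenspace {m : ℕ} {f : Omega → ℂ}
    (hf : f ∈ eigenspace (4 * (m : ℂ) * ((m : ℂ) + 1))) :
    IsFiniteEigen m (pull f false false) := by
  refine ⟨hf.1.sepHol, fun z w hzw => ?_⟩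
  have h := hf.2 ⟨((z : OnePoint ℂ), (w : OnePoint ℂ)), coe_mem_Omega.2 hzw⟩
  rw [pull_finite f hzw]
  have h' : 4 * (1 - z * w) ^ 2 * derivFst (derivSnd (pull f false false)) z w = _ := h
  linear_combination h' / 4

theorem exists_bound_of_eq_comp_inv {G H : ℂ → ℂ} (hc : ContinuousAt H 0)
    (h : ∀ w, w ≠ 0 → G w = H w⁻¹) : ∃ C R : ℝ, ∀ w : ℂ, R ≤ ‖w‖ → ‖G w‖ ≤ C := by
  obtain ⟨δ, hδ, hδ'⟩ := Metric.continuousAt_iff.1 hc 1 one_pos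
  refine ⟨‖H 0‖ + 1, 2 / δ, fun w hw => ?_⟩
  have hw0 : 0 < ‖w‖ := lt_of_lt_of_le (by positivity) hw
  have h1 : dist w⁻¹ 0 < δ := by
    rw [dist_zero_right, norm_inv]
    refine inv_lt_of_inv_lt₀ hδ (lt_of_lt_of_le ?_ hw)
    rw [inv_eq_one_div]
    gcongr
    norm_num
  have h2 := hδ' h1
  rw [dist_eq_norm] at h2
  rw [h w (norm_pos_iff.1 hw0)]
  linarith [norm_sub_norm_le (H w⁻¹) (H 0)]

/-- A holomorphic function on `Ω` stays bounded as one variable tends to `∞` and the other is `1`,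
as `(1, ∞)` and `(∞, 1)` belong to `Ω`. -/
theorem IsHolomorphic.bounded_snd {f : Omega → ℂ} (hf : IsHolomorphic f) :
    ∃ C R : ℝ, ∀ w : ℂ, R ≤ ‖w‖ → ‖pull f false false 1 w‖ ≤ C := by
  have hmem : ((1 : ℂ), (0 : ℂ)) ∈ {q : ℂ × ℂ | (chart false q.1, chart true q.2) ∈ Omega} := by
    simp [chart_mem_Omega, num, den]
  have hc := ((hf false true).differentiableAt
    ((isOpen_chart_mem_Omega false true).mem_nhds hmem)).continuousAt
  refine exists_bound_of_eq_comp_inv (H := fun y => pull f false true 1 y)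
    (ContinuousAt.comp (f := fun y : ℂ => ((1 : ℂ), y)) (x := 0) hc (by fun_prop)) fun w hw => ?_
  exact pull_congr f rfl (by simp [chart, hw])

theorem IsHolomorphic.bounded_fst {f : Omega → ℂ} (hf : IsHolomorphic f) :
    ∃ C R : ℝ, ∀ z : ℂ, R ≤ ‖z‖ → ‖pull f false false z 1‖ ≤ C := by
  have hmem : ((0 : ℂ), (1 : ℂ)) ∈ {q : ℂ × ℂ | (chart true q.1, chart false q.2) ∈ Omega} := by
    simp [chart_mem_Omega, num, den]
  have hc := ((hf true false).differentiableAt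
    ((isOpen_chart_mem_Omega true false).mem_nhds hmem)).continuousAt
  refine exists_bound_of_eq_comp_inv (H := fun x => pull f true false x 1)
    (ContinuousAt.comp (f := fun x : ℂ => (x, (1 : ℂ))) (x := 0) hc (by fun_prop)) fun z hz => ?_
  exact pull_congr f (by simp [chart, hz]) rfl

theorem pull_coeffMode_zero_left {m k : ℕ} (hk : k ≤ 2 * m) (w : ℂ) :
    pull (coeffMode m k) false false 0 w = m.choose k * w ^ (m - k) := by
  rw [pull_coeffMode hk (by simp)]
  have e : modePoly m 0 1 w 1 = (C w + C 1 * X) ^ m := by simp [modePoly]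
  rw [e, coeff_linear_pow]
  simp

theorem pull_coeffMode_zero_right {m k : ℕ} (hk : k ≤ 2 * m) (z : ℂ) :
    pull (coeffMode m k) false false z 0 =
      if m ≤ k then m.choose (k - m) * z ^ (k - m) else 0 := by
  rw [pull_coeffMode hk (by simp)]
  have e : modePoly m z 1 0 1 = (C 1 + C z * X) ^ m * X ^ m := by simp [modePoly]
  rw [e, coeff_mul_X_pow', coeff_linear_pow]
  simp

/-- The eigenspace is spanned by the `2 m + 1` modes: on the axes an eigenfunction is a polynomial of
degree at most `m`, as is a suitable combination of the modes. -/
theorem exists_eq_sum_coeffMode {m : ℕ} {f : Omega → ℂ}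
    (hf : f ∈ eigenspace (4 * (m : ℂ) * ((m : ℂ) + 1))) :
    ∃ c : ℕ → ℂ, ∀ p, f p = ∑ k ∈ Finset.range (2 * m + 1), c k * coeffMode m k p := by
  have hF := isFiniteEigen_of_mem_eigenspace hf
  obtain ⟨C₁, R₁, h₁⟩ := hf.1.bounded_snd
  obtain ⟨C₂, R₂, h₂⟩ := hf.1.bounded_fst
  obtain ⟨α, hα⟩ := hF.eq_sum_snd h₁
  obtain ⟨β, hβ⟩ := hF.flip.eq_sum_snd h₂
  have hαβ : α 0 = β 0 := by
    have e1 := hα 0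
    have e2 := hβ 0
    rw [Finset.sum_range_succ', Finset.sum_eq_zero (fun i _ => by simp)] at e1 e2
    rw [e1] at e2
    simpa using e2
  -- on the axes the `k`-th mode is `binom(m, k) w^{m-k}` or `binom(m, k-m) z^{k-m}`, or it vanishes
  set c : ℕ → ℂ := fun k =>
    if k ≤ m then α (m - k) / m.choose k else β (k - m) / m.choose (k - m) with hc
  have hchoose : ∀ k ≤ m, (m.choose k : ℂ) ≠ 0 := fun k hk => by
    exact_mod_cast (Nat.choose_pos hk).ne'
  have hg : IsHolomorphic fun p => ∑ k ∈ Finset.range (2 * m + 1), c k * coeffMode m k p :=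
    IsHolomorphic.sum _ _ fun k _ => isHolomorphic_coeffMode m k
  have hG : IsFiniteEigen m (pull (fun p => ∑ k ∈ Finset.range (2 * m + 1),
      c k * coeffMode m k p) false false) := by
    have e : pull (fun p => ∑ k ∈ Finset.range (2 * m + 1), c k * coeffMode m k p) false false =
        fun z w => ∑ k ∈ Finset.range (2 * m + 1), c k * pull (coeffMode m k) false false z w := by
      funext z w
      exact pull_sum _ _ _ _ _ _ _
    have hs := hg.sepHol
    rw [e] at hs ⊢
    exact IsFiniteEigen.sum _ _
      (fun k hk => isFiniteEigen_coeffMode (Nat.lt_succ_iff.1 (Finset.mem_range.1 hk))) hs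
  refine ⟨c, fun p => hf.1.ext hg (fun z w hzw => ?_) p⟩
  refine sub_eq_zero.1 ((hF.sub hG).eq_zero (fun z => ?_) (fun w => ?_) hzw)
  · have hβz : pull f false false z 0 = _ := hβ z
    have split : ∀ g : ℕ → ℂ, ∑ k ∈ Finset.range (2 * m + 1), g k =
        ∑ k ∈ Finset.range m, g k + ∑ k ∈ Finset.range (m + 1), g (m + k) := fun g => by
      rw [← Finset.sum_range_add, show 2 * m + 1 = m + (m + 1) by ring]
    rw [hβz, pull_sum, split, Finset.sum_eq_zero (s := Finset.range m), zero_add, sub_eq_zero]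
    · refine Finset.sum_congr rfl fun k hk => ?_
      have hk' : k ≤ m := Nat.lt_succ_iff.1 (Finset.mem_range.1 hk)
      rw [pull_coeffMode_zero_right (by omega), if_pos (by omega), Nat.add_sub_cancel_left]
      have e : c (m + k) = β k / m.choose k := by
        rw [hc]
        rcases Nat.eq_zero_or_pos k with rfl | hk0
        · simp [hαβ]
        · simp only [if_neg (show ¬ m + k ≤ m by omega), Nat.add_sub_cancel_left]
      rw [e]
      have := hchoose k hk'
      field_simp
    · intro k hk
      have hk' := Finset.mem_range.1 hk
      rw [pull_coeffMode_zero_right (by omega), if_neg (by omega), mul_zero]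
  · have split : ∀ g : ℕ → ℂ, ∑ k ∈ Finset.range (2 * m + 1), g k =
        ∑ k ∈ Finset.range (m + 1), g k + ∑ k ∈ Finset.range m, g (m + 1 + k) := fun g => by
      rw [← Finset.sum_range_add, show 2 * m + 1 = m + 1 + m by ring]
    rw [hα w, pull_sum, split, Finset.sum_eq_zero (s := Finset.range m), add_zero, sub_eq_zero,
      ← Finset.sum_flip]
    · refine Finset.sum_congr rfl fun k hk => ?_
      have hk' : k ≤ m := Nat.lt_succ_iff.1 (Finset.mem_range.1 hk)
      rw [pull_coeffMode_zero_left (by omega), hc]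
      simp only [if_pos hk']
      have := hchoose k hk'
      field_simp
    · intro k hk
      have hk' := Finset.mem_range.1 hk
      rw [pull_coeffMode_zero_left (by omega), Nat.choose_eq_zero_of_lt (by omega)]
      simp

/-! ### Integrals of monomials over the sphere -/

theorem tendsto_one_add_sq_pow_inv (N : ℕ) :
    Tendsto (fun r : ℝ => ((1 + r ^ 2) ^ (N + 1))⁻¹) atTop (𝓝 0) := by
  refine tendsto_inv_atTop_zero.comp ?_
  refine (tendsto_pow_atTop (Nat.succ_ne_zero N)).comp ?_
  exact tendsto_atTop_add_const_left _ _ (tendsto_pow_atTop two_ne_zero)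

/-- A beta integral, with the recursion given by integration by parts. -/
theorem integral_radial {k N : ℕ} (hk : k ≤ N) :
    IntegrableOn (fun r : ℝ => r ^ (2 * k + 1) / (1 + r ^ 2) ^ (N + 2)) (Set.Ioi 0) ∧
    ∫ r in Set.Ioi (0 : ℝ), r ^ (2 * k + 1) / (1 + r ^ 2) ^ (N + 2) =
      (k.factorial * (N - k).factorial / (2 * (N + 1).factorial) : ℝ) := by
  have hbase : ∀ r : ℝ, HasDerivAt (fun r : ℝ => 1 + r ^ 2) (2 * r) r := fun r => by
    simpa using (hasDerivAt_pow 2 r).const_add 1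
  have hpos : ∀ r : ℝ, 0 < 1 + r ^ 2 := fun r => by positivity
  induction k generalizing N with
  | zero =>
    have hd : ∀ r : ℝ, HasDerivAt (fun r : ℝ => -(1 / (2 * ((N : ℝ) + 1))) * ((1 + r ^ 2) ^ (N + 1))⁻¹)
        (r ^ (2 * 0 + 1) / (1 + r ^ 2) ^ (N + 2)) r := fun r => by
      have h0 := (hpos r).ne'
      refine ((((hbase r).pow (N + 1)).inv (pow_ne_zero _ h0)).const_mul _).congr_deriv ?_
      simp only [Pi.pow_apply, Nat.add_sub_cancel]
      push_cast
      field_simp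
      ring
    have hlim : Tendsto (fun r : ℝ => -(1 / (2 * ((N : ℝ) + 1))) * ((1 + r ^ 2) ^ (N + 1))⁻¹) atTop
        (𝓝 0) := by
      simpa using (tendsto_one_add_sq_pow_inv N).const_mul (-(1 / (2 * ((N : ℝ) + 1))))
    have hint := integrableOn_Ioi_deriv_of_nonneg' (a := 0) (fun r _ => hd r)
      (fun r hr => by have := Set.mem_Ioi.1 hr; positivity) hlim
    refine ⟨hint, ?_⟩
    rw [integral_Ioi_of_hasDerivAt_of_tendsto (hd 0).continuousAt.continuousWithinAt
      (fun r _ => hd r) hint hlim]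
    have hN : (N.factorial : ℝ) ≠ 0 := by exact_mod_cast N.factorial_ne_zero
    rw [Nat.factorial_succ]
    push_cast
    simp
    field_simp
  | succ k ih =>
    obtain ⟨M, rfl⟩ : ∃ M, N = M + 1 := ⟨N - 1, by omega⟩
    obtain ⟨ihint, ihval⟩ := ih (N := M) (by omega)
    have hd : ∀ r : ℝ, HasDerivAt (fun r : ℝ => r ^ (2 * k + 2) / (1 + r ^ 2) ^ (M + 2))
        ((2 * k + 2) * (r ^ (2 * k + 1) / (1 + r ^ 2) ^ (M + 2)) -
          2 * (M + 2) * (r ^ (2 * (k + 1) + 1) / (1 + r ^ 2) ^ (M + 1 + 2))) r := fun r => by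
      have h0 := (hpos r).ne'
      refine ((hasDerivAt_pow (2 * k + 2) r).div ((hbase r).pow (M + 2))
        (pow_ne_zero _ h0)).congr_deriv ?_
      simp only [Pi.pow_apply, show 2 * k + 2 - 1 = 2 * k + 1 by omega,
        show M + 2 - 1 = M + 1 by omega]
      push_cast
      field_simp
      ring
    have hlim : Tendsto (fun r : ℝ => r ^ (2 * k + 2) / (1 + r ^ 2) ^ (M + 2)) atTop (𝓝 0) := by
      refine squeeze_zero (fun r => div_nonneg (Even.pow_nonneg ⟨k + 1, by ring⟩ r)
        (pow_pos (hpos r) _).le) (fun r => ?_) (tendsto_one_add_sq_pow_inv 0)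
      have h1 : r ^ (2 * k + 2) ≤ (1 + r ^ 2) ^ (M + 1) := by
        calc r ^ (2 * k + 2) = (r ^ 2) ^ (k + 1) := by ring
          _ ≤ (1 + r ^ 2) ^ (k + 1) := by gcongr; linarith
          _ ≤ (1 + r ^ 2) ^ (M + 1) := pow_le_pow_right₀ (by nlinarith) (by omega)
      rw [div_le_iff₀ (by positivity), pow_succ (1 + r ^ 2) (M + 1), zero_add, pow_one]
      have := (hpos r).ne'
      field_simp
      exact h1
    have hint : IntegrableOn (fun r : ℝ => r ^ (2 * (k + 1) + 1) / (1 + r ^ 2) ^ (M + 1 + 2))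
        (Set.Ioi 0) := by
      refine Integrable.mono' ihint (Continuous.aestronglyMeasurable ?_) ?_
      · exact Continuous.div (by fun_prop) (by fun_prop) fun r => (pow_pos (hpos r) _).ne'
      · refine (ae_restrict_iff' measurableSet_Ioi).2 (Eventually.of_forall fun r hr => ?_)
        have hr0 : 0 < r := hr
        rw [Real.norm_of_nonneg (by positivity), div_le_div_iff₀ (by positivity) (by positivity)]
        have : r ^ 2 ≤ 1 + r ^ 2 := by linarith
        calc r ^ (2 * (k + 1) + 1) * (1 + r ^ 2) ^ (M + 2) =
            r ^ (2 * k + 1) * (1 + r ^ 2) ^ (M + 2) * r ^ 2 := by ring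
          _ ≤ r ^ (2 * k + 1) * (1 + r ^ 2) ^ (M + 2) * (1 + r ^ 2) := by gcongr
          _ = r ^ (2 * k + 1) * (1 + r ^ 2) ^ (M + 1 + 2) := by ring
    refine ⟨hint, ?_⟩
    have h1 := ihint.const_mul (2 * (k : ℝ) + 2)
    have h2 := hint.const_mul (2 * ((M : ℝ) + 2))
    have h3 := integral_Ioi_of_hasDerivAt_of_tendsto (hd 0).continuousAt.continuousWithinAt
      (fun r _ => hd r) (h1.sub h2) hlim
    rw [integral_sub h1 h2, integral_const_mul, integral_const_mul, ihval] at h3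
    have hM : ((M + 1).factorial : ℝ) ≠ 0 := by exact_mod_cast (M + 1).factorial_ne_zero
    have hM2 : (M : ℝ) + 2 ≠ 0 := by positivity
    rw [show M + 1 - (k + 1) = M - k by omega, Nat.factorial_succ (M + 1), Nat.factorial_succ k]
    push_cast
    have h4 : 2 * ((M : ℝ) + 2) * ∫ r in Set.Ioi (0 : ℝ),
        r ^ (2 * (k + 1) + 1) / (1 + r ^ 2) ^ (M + 1 + 2) =
        (2 * k + 2) * (k.factorial * (M - k).factorial / (2 * (M + 1).factorial)) := by
      simp only [ne_eq, Nat.add_eq_zero_iff, OfNat.ofNat_ne_zero, and_false, not_false_eq_true,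
        zero_pow, zero_div, sub_zero] at h3
      linarith
    rw [show (M : ℝ) + 1 + 1 = M + 2 by ring]
    refine mul_left_cancel₀ (mul_ne_zero two_ne_zero hM2) (h4.trans ?_)
    field_simp

theorem integral_angular (k l : ℕ) :
    ∫ θ in Set.Ioo (-Real.pi) Real.pi, Complex.exp ((((k : ℂ) - l) * Complex.I) * θ) =
      if k = l then (2 * Real.pi : ℂ) else 0 := by
  rw [← integral_Ioc_eq_integral_Ioo,
    ← intervalIntegral.integral_of_le (by linarith [Real.pi_pos])]
  split_ifs with h
  · subst h
    simp
    ring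
  · have hc : ((k : ℂ) - l) * Complex.I ≠ 0 := by
      refine mul_ne_zero (sub_ne_zero.2 ?_) Complex.I_ne_zero
      exact_mod_cast h
    rw [integral_exp_mul_complex hc]
    have e : Complex.exp (((k : ℂ) - l) * Complex.I * (Real.pi : ℝ)) =
        Complex.exp (((k : ℂ) - l) * Complex.I * ((-Real.pi : ℝ) : ℂ)) := by
      rw [← mul_one (Complex.exp (((k : ℂ) - l) * Complex.I * ((-Real.pi : ℝ) : ℂ))),
        ← Complex.exp_int_mul_two_pi_mul_I ((k : ℤ) - l), ← Complex.exp_add]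
      congr 1
      push_cast
      ring
    rw [e, sub_self, zero_div]

/-- The monomials `η ^ k * conj η ^ l` are orthogonal by rotation invariance. -/
theorem integral_monomial {k l N : ℕ} (hk : k ≤ N) :
    ∫ η : ℂ, η ^ k * (starRingEnd ℂ) η ^ l / (((1 + ‖η‖ ^ 2) ^ (N + 2) : ℝ) : ℂ) =
      if k = l then (Real.pi * (k.factorial * (N - k).factorial / (N + 1).factorial) : ℂ) else 0 := by
  rw [← Complex.integral_comp_polarCoord_symm, polarCoord_target]
  have e : ∀ p ∈ (Set.Ioi (0 : ℝ) ×ˢ Set.Ioo (-Real.pi) Real.pi), p.1 •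
      (Complex.polarCoord.symm p ^ k * (starRingEnd ℂ) (Complex.polarCoord.symm p) ^ l /
        (((1 + ‖Complex.polarCoord.symm p‖ ^ 2) ^ (N + 2) : ℝ) : ℂ)) =
      ((p.1 ^ (k + l + 1) / (1 + p.1 ^ 2) ^ (N + 2) : ℝ) : ℂ) *
        Complex.exp ((((k : ℂ) - l) * Complex.I) * p.2) := by
    rintro ⟨r, θ⟩ ⟨hr, -⟩
    have hr0 : 0 < r := hr
    have h1 : Complex.polarCoord.symm (r, θ) = r * Complex.exp (θ * Complex.I) := by
      rw [Complex.polarCoord_symm_apply, Complex.exp_mul_I, Complex.ofReal_cos, Complex.ofReal_sin]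
    have h2 : ‖(r * Complex.exp (θ * Complex.I) : ℂ)‖ = r := by
      rw [norm_mul, Complex.norm_exp_ofReal_mul_I, mul_one, Complex.norm_real,
        Real.norm_of_nonneg hr0.le]
    rw [h1, h2, map_mul, Complex.conj_ofReal, ← Complex.exp_conj, map_mul, Complex.conj_ofReal,
      Complex.conj_I, mul_pow, mul_pow, ← Complex.exp_nat_mul, ← Complex.exp_nat_mul,
      Complex.real_smul]
    have h3 : Complex.exp (((k : ℂ) - l) * Complex.I * θ) =
        Complex.exp (k * (θ * Complex.I)) * Complex.exp (l * (θ * -Complex.I)) := by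
      rw [← Complex.exp_add]
      congr 1
      ring
    simp only [h3]
    push_cast
    ring
  rw [setIntegral_congr_fun (measurableSet_Ioi.prod measurableSet_Ioo) e,
    Measure.volume_eq_prod, setIntegral_prod_mul
      (fun r : ℝ => ((r ^ (k + l + 1) / (1 + r ^ 2) ^ (N + 2) : ℝ) : ℂ))
      (fun θ : ℝ => Complex.exp ((((k : ℂ) - l) * Complex.I) * θ)), integral_angular]
  split_ifs with h
  · subst h
    rw [integral_complex_ofReal, ← two_mul, (integral_radial hk).2]
    push_cast
    have : ((N + 1).factorial : ℂ) ≠ 0 := by exact_mod_cast (N + 1).factorial_ne_zero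
    field_simp
  · rw [mul_zero]

theorem norm_pow_le {m j : ℕ} (hj : j ≤ 2 * m) (η : ℂ) : ‖η‖ ^ j ≤ (1 + ‖η‖ ^ 2) ^ m := by
  rcases le_total ‖η‖ 1 with h | h
  · exact (pow_le_one₀ (norm_nonneg _) h).trans (one_le_pow₀ (by nlinarith [norm_nonneg η]))
  · calc ‖η‖ ^ j ≤ ‖η‖ ^ (2 * m) := pow_le_pow_right₀ h hj
      _ = (‖η‖ ^ 2) ^ m := by rw [pow_mul]
      _ ≤ (1 + ‖η‖ ^ 2) ^ m := by gcongr; linarith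

theorem integrable_sphere_weight :
    Integrable (fun η : ℂ => ((((1 + ‖η‖ ^ 2) ^ 2)⁻¹ : ℝ) : ℂ)) := by
  have h := integrable_rpow_neg_one_add_norm_sq (E := ℂ) (μ := volume) (r := 4)
    (by rw [Complex.finrank_real_complex]; norm_num)
  refine (h.congr (Eventually.of_forall fun η => ?_)).ofReal
  have h0 : 0 ≤ 1 + ‖η‖ ^ 2 := by positivity
  simp only
  rw [show (-4 / 2 : ℝ) = -((2 : ℕ) : ℝ) by norm_num, Real.rpow_neg h0, Real.rpow_natCast]
  rfl

/-- Bounded continuous functions are integrable over the sphere. -/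
theorem integrable_of_bounded {g : ℂ → ℂ} (hg : Continuous g) {B : ℝ} (hB : ∀ η, ‖g η‖ ≤ B) :
    Integrable fun η : ℂ => g η / (((1 + ‖η‖ ^ 2) ^ 2 : ℝ) : ℂ) := by
  have h := integrable_sphere_weight.bdd_mul hg.aestronglyMeasurable (Eventually.of_forall hB)
  refine h.congr (Eventually.of_forall fun η => ?_)
  simp only
  rw [Complex.ofReal_inv, div_eq_mul_inv]

/-! ### Orthogonality of the modes and the reproducing property -/

theorem mul_neg_conj_ne_one (η : ℂ) : η * -(starRingEnd ℂ) η ≠ 1 := by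
  rw [← coe_mem_Omega]
  exact (rotDiag η).2

theorem one_sub_mul_neg_conj (η : ℂ) :
    1 - η * -(starRingEnd ℂ) η = ((1 + ‖η‖ ^ 2 : ℝ) : ℂ) := by
  rw [mul_neg, sub_neg_eq_add, Complex.mul_conj, Complex.normSq_eq_norm_sq]
  push_cast
  rfl

theorem coeffMode_rotDiag {m k : ℕ} (hk : k ≤ 2 * m) (η : ℂ) :
    coeffMode m k (rotDiag η) = ∑ i ∈ Finset.range (k + 1),
      ((m.choose i : ℂ) * η ^ i) * ((m.choose (k - i) : ℂ) *
        (-(starRingEnd ℂ) η) ^ (m - (k - i))) * (((1 + ‖η‖ ^ 2) ^ m : ℝ) : ℂ)⁻¹ := by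
  have h := pull_finite (coeffMode m k) (mul_neg_conj_ne_one η)
  rw [pull_coeffMode hk (mul_neg_conj_ne_one η), one_sub_mul_neg_conj, modePoly, coeff_mul,
    Finset.Nat.sum_antidiagonal_eq_sum_range_succ_mk] at h
  refine h.symm.trans ?_
  simp only [Finset.sum_mul, coeff_linear_pow, one_pow, mul_one, Complex.ofReal_pow,
    Nat.succ_eq_add_one]

theorem exists_bound_coeffMode {m k : ℕ} (hk : k ≤ 2 * m) :
    ∃ B : ℝ, ∀ η, ‖coeffMode m k (rotDiag η)‖ ≤ B := by
  refine ⟨∑ i ∈ Finset.range (k + 1), (m.choose i : ℝ) * m.choose (k - i), fun η => ?_⟩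
  rw [coeffMode_rotDiag hk]
  refine norm_sum_le_of_le _ fun i _ => ?_
  have h0 : (0 : ℝ) < (1 + ‖η‖ ^ 2) ^ m := by positivity
  rw [norm_mul, norm_mul, norm_mul, norm_mul, norm_pow, norm_pow, norm_neg, RCLike.norm_conj,
    norm_inv, Complex.norm_real, Real.norm_of_nonneg h0.le, Complex.norm_natCast,
    Complex.norm_natCast, ← div_eq_mul_inv, div_le_iff₀ h0]
  rcases le_or_gt i m with hi | hi
  · calc (m.choose i : ℝ) * ‖η‖ ^ i * (m.choose (k - i) * ‖η‖ ^ (m - (k - i))) =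
        m.choose i * m.choose (k - i) * ‖η‖ ^ (i + (m - (k - i))) := by ring
      _ ≤ m.choose i * m.choose (k - i) * (1 + ‖η‖ ^ 2) ^ m := by
        gcongr
        exact norm_pow_le (by omega) η
  · simp [Nat.choose_eq_zero_of_lt hi]

theorem continuous_coeffMode {m k : ℕ} (hk : k ≤ 2 * m) :
    Continuous fun η => coeffMode m k (rotDiag η) := by
  simp only [coeffMode_rotDiag hk]
  have hc : Continuous fun η : ℂ => (((1 + ‖η‖ ^ 2) ^ m : ℝ) : ℂ)⁻¹ := by
    refine Continuous.inv₀ (by fun_prop) fun η => ?_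
    have : (1 + ‖η‖ ^ 2) ^ m ≠ 0 := by positivity
    exact_mod_cast this
  have hconj : Continuous (starRingEnd ℂ) := Complex.continuous_conj
  fun_prop

/-- The integrand of the pairing of two modes over the rotated diagonal. -/
noncomputable def pairDensity (m k l : ℕ) (η : ℂ) : ℂ :=
  coeffMode m k (rotDiag η) * coeffMode m l (rotDiag η) / (((1 + ‖η‖ ^ 2) ^ 2 : ℝ) : ℂ)

theorem integrable_pairDensity {m k l : ℕ} (hk : k ≤ 2 * m) (hl : l ≤ 2 * m) :
    Integrable (pairDensity m k l) := by
  obtain ⟨B, hB⟩ := exists_bound_coeffMode hk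
  obtain ⟨B', hB'⟩ := exists_bound_coeffMode hl
  refine integrable_of_bounded ((continuous_coeffMode hk).mul (continuous_coeffMode hl))
    (B := B * B') fun η => ?_
  rw [norm_mul]
  exact mul_le_mul (hB η) (hB' η) (norm_nonneg _) ((norm_nonneg _).trans (hB η))

theorem integrable_monomial {k l N : ℕ} (hk : k ≤ 2 * N) (hl : l ≤ 2 * N) :
    Integrable fun η : ℂ =>
      η ^ k * (starRingEnd ℂ) η ^ l / (((1 + ‖η‖ ^ 2) ^ (2 * N + 2) : ℝ) : ℂ) := by
  have hpos : ∀ η : ℂ, (0 : ℝ) < (1 + ‖η‖ ^ 2) ^ (2 * N) := fun η => by positivity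
  have hne : ∀ η : ℂ, (((1 + ‖η‖ ^ 2) ^ (2 * N) : ℝ) : ℂ) ≠ 0 := fun η => by
    exact_mod_cast (hpos η).ne'
  have h := integrable_of_bounded (B := 1)
    (g := fun η : ℂ => η ^ k * (starRingEnd ℂ) η ^ l / (((1 + ‖η‖ ^ 2) ^ (2 * N) : ℝ) : ℂ))
    (Continuous.div ((continuous_pow k).mul (Complex.continuous_conj.pow l)) (by fun_prop) hne)
    fun η => by
      rw [norm_div, norm_mul, norm_pow, norm_pow, RCLike.norm_conj, Complex.norm_real,
        Real.norm_of_nonneg (hpos η).le, div_le_one (hpos η), two_mul, pow_add]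
      exact mul_le_mul (norm_pow_le hk η) (norm_pow_le hl η) (by positivity) (by positivity)
  refine h.congr (Eventually.of_forall fun η => ?_)
  simp only
  rw [div_div, ← Complex.ofReal_mul, ← pow_add]

/-- The pairing of two generating functions is the invariant form, evaluated at the polynomial
`((1 + s x) (1 + σ x)) ^ m`. -/
theorem integral_genMode_mul (m : ℕ) (s σ : ℂ) :
    ∫ η : ℂ, genMode m s η (-(starRingEnd ℂ) η) * genMode m σ η (-(starRingEnd ℂ) η) /
      (((1 + ‖η‖ ^ 2) ^ 2 : ℝ) : ℂ) =
    Real.pi / ((2 * m + 1).factorial : ℂ) *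
      ((-1) ^ m * (m.factorial : ℂ) ^ 2 * (σ - s) ^ (2 * m)) := by
  set A := modePoly m s 1 1 σ with hA
  -- the factors in `conj η` give the reversed polynomial, with alternating signs
  have hB : ∀ l ≤ 2 * m, (modePoly m (-1) s σ (-1)).coeff l = (-1) ^ l * A.coeff (2 * m - l) := by
    intro l hl
    rw [coeff_modePoly_neg, coeff_modePoly_reverse m _ _ _ _ hl, modePoly_comm]
  have hexp : ∀ η : ℂ, genMode m s η (-(starRingEnd ℂ) η) * genMode m σ η (-(starRingEnd ℂ) η) /
      (((1 + ‖η‖ ^ 2) ^ 2 : ℝ) : ℂ) =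
      ∑ k ∈ Finset.range (2 * m + 1), ∑ l ∈ Finset.range (2 * m + 1),
        (A.coeff k * ((-1) ^ l * A.coeff (2 * m - l))) *
        (η ^ k * (starRingEnd ℂ) η ^ l / (((1 + ‖η‖ ^ 2) ^ (2 * m + 2) : ℝ) : ℂ)) := by
    intro η
    have e1 := sum_pow_mul_coeff_modePoly m s 1 1 σ η
    have e2 := sum_pow_mul_coeff_modePoly m (-1) s σ (-1) ((starRingEnd ℂ) η)
    have e3 : genMode m s η (-(starRingEnd ℂ) η) * genMode m σ η (-(starRingEnd ℂ) η) /
        (((1 + ‖η‖ ^ 2) ^ 2 : ℝ) : ℂ) =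
        ((1 + s * η) * (1 + σ * η)) ^ m * ((s + -1 * (starRingEnd ℂ) η) *
          (σ + -1 * (starRingEnd ℂ) η)) ^ m / (((1 + ‖η‖ ^ 2) ^ (2 * m + 2) : ℝ) : ℂ) := by
      rw [genMode, genMode, one_sub_mul_neg_conj, ← mul_pow, ← mul_pow, div_mul_div_comm, div_pow,
        div_div]
      congr 1
      · congr 1
        ring
      · push_cast
        rw [mul_pow]
        ring
    rw [e3, ← e1, ← e2, Finset.sum_mul_sum, Finset.sum_div]
    refine Finset.sum_congr rfl fun k _ => ?_
    rw [Finset.sum_div]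
    refine Finset.sum_congr rfl fun l hl => ?_
    rw [hB l (Nat.lt_succ_iff.1 (Finset.mem_range.1 hl))]
    ring
  simp only [hexp]
  have hint : ∀ k ∈ Finset.range (2 * m + 1), ∀ l ∈ Finset.range (2 * m + 1),
      Integrable fun η : ℂ => (A.coeff k * ((-1) ^ l * A.coeff (2 * m - l))) *
        (η ^ k * (starRingEnd ℂ) η ^ l / (((1 + ‖η‖ ^ 2) ^ (2 * m + 2) : ℝ) : ℂ)) :=
    fun k hk l hl => (integrable_monomial (Nat.lt_succ_iff.1 (Finset.mem_range.1 hk))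
      (Nat.lt_succ_iff.1 (Finset.mem_range.1 hl))).const_mul _
  rw [integral_finsetSum _ fun k hk => integrable_finsetSum _ (hint k hk)]
  have hsum : ∀ k ∈ Finset.range (2 * m + 1),
      ∫ η : ℂ, ∑ l ∈ Finset.range (2 * m + 1), (A.coeff k * ((-1) ^ l * A.coeff (2 * m - l))) *
        (η ^ k * (starRingEnd ℂ) η ^ l / (((1 + ‖η‖ ^ 2) ^ (2 * m + 2) : ℝ) : ℂ)) =
      Real.pi / ((2 * m + 1).factorial : ℂ) * ((-1) ^ k * (k.factorial : ℂ) *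
        ((2 * m - k).factorial : ℂ) * A.coeff k * A.coeff (2 * m - k)) := by
    intro k hk
    rw [integral_finsetSum _ (hint k hk), Finset.sum_eq_single k]
    · rw [integral_const_mul, integral_monomial (Nat.lt_succ_iff.1 (Finset.mem_range.1 hk)),
        if_pos rfl]
      ring
    · intro l _ hl
      rw [integral_const_mul, integral_monomial (Nat.lt_succ_iff.1 (Finset.mem_range.1 hk)),
        if_neg (Ne.symm hl), mul_zero]
    · exact fun h => absurd hk h
  rw [Finset.sum_congr rfl hsum, ← Finset.mul_sum]
  have := invForm_modePoly m s 1 1 σ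
  rw [invForm] at this
  rw [this, one_mul, mul_one]

/-- The pairings of the modes are the coefficients of a multiple of `(σ - s) ^ (2 m)`. -/
theorem integral_pairDensity {m k l : ℕ} (hk : k ≤ 2 * m) (hl : l ≤ 2 * m) :
    ∫ η : ℂ, pairDensity m k l η = if l = 2 * m - k then
      Real.pi / ((2 * m + 1).factorial : ℂ) * ((-1) ^ m * (m.factorial : ℂ) ^ 2 *
        ((-1) ^ k * ((2 * m).choose k : ℂ))) else 0 := by
  set K : ℂ := Real.pi / ((2 * m + 1).factorial : ℂ) * ((-1) ^ m * (m.factorial : ℂ) ^ 2) with hK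
  -- both sides are the pairing of two generating functions
  have hgen : ∀ s σ : ℂ, ∑ k ∈ Finset.range (2 * m + 1), s ^ k *
      ∑ l ∈ Finset.range (2 * m + 1), σ ^ l * ∫ η : ℂ, pairDensity m k l η =
      ∑ k ∈ Finset.range (2 * m + 1), s ^ k *
        (K * ((-1) ^ k * ((2 * m).choose k : ℂ)) * σ ^ (2 * m - k)) := by
    intro s σ
    have hint : ∀ k ∈ Finset.range (2 * m + 1), ∀ l ∈ Finset.range (2 * m + 1),
        Integrable fun η : ℂ => s ^ k * (σ ^ l * pairDensity m k l η) := fun k hk l hl =>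
      ((integrable_pairDensity (Nat.lt_succ_iff.1 (Finset.mem_range.1 hk))
        (Nat.lt_succ_iff.1 (Finset.mem_range.1 hl))).const_mul _).const_mul _
    have e1 : ∑ k ∈ Finset.range (2 * m + 1), s ^ k *
        ∑ l ∈ Finset.range (2 * m + 1), σ ^ l * ∫ η : ℂ, pairDensity m k l η =
        ∫ η : ℂ, genMode m s η (-(starRingEnd ℂ) η) * genMode m σ η (-(starRingEnd ℂ) η) /
          (((1 + ‖η‖ ^ 2) ^ 2 : ℝ) : ℂ) := by
      have e2 : ∀ η : ℂ, genMode m s η (-(starRingEnd ℂ) η) *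
          genMode m σ η (-(starRingEnd ℂ) η) / (((1 + ‖η‖ ^ 2) ^ 2 : ℝ) : ℂ) =
          ∑ k ∈ Finset.range (2 * m + 1), ∑ l ∈ Finset.range (2 * m + 1),
            s ^ k * (σ ^ l * pairDensity m k l η) := by
        intro η
        rw [← sum_pow_mul_coeffMode m s (mul_neg_conj_ne_one η),
          ← sum_pow_mul_coeffMode m σ (mul_neg_conj_ne_one η), Finset.sum_mul_sum, Finset.sum_div]
        refine Finset.sum_congr rfl fun k _ => ?_
        rw [Finset.sum_div]
        refine Finset.sum_congr rfl fun l _ => ?_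
        rw [pull_finite _ (mul_neg_conj_ne_one η), pull_finite _ (mul_neg_conj_ne_one η),
          pairDensity, rotDiag]
        ring
      simp only [e2]
      rw [integral_finsetSum _ fun k hk => integrable_finsetSum _ (hint k hk)]
      refine Finset.sum_congr rfl fun k hk => ?_
      rw [integral_finsetSum _ (hint k hk), Finset.mul_sum]
      refine Finset.sum_congr rfl fun l _ => ?_
      rw [integral_const_mul, integral_const_mul]
    rw [e1, integral_genMode_mul, ← mul_assoc, ← hK, sub_eq_neg_add, add_pow, Finset.mul_sum]
    refine Finset.sum_congr rfl fun k _ => ?_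
    rw [neg_pow s]
    ring
  have h1 : ∀ σ : ℂ, ∑ l ∈ Finset.range (2 * m + 1), σ ^ l * ∫ η : ℂ, pairDensity m k l η =
      K * ((-1) ^ k * ((2 * m).choose k : ℂ)) * σ ^ (2 * m - k) := fun σ =>
    coeff_eq_of_sum_pow_eq (a := fun k => ∑ l ∈ Finset.range (2 * m + 1),
        σ ^ l * ∫ η : ℂ, pairDensity m k l η)
      (b := fun k => K * ((-1) ^ k * ((2 * m).choose k : ℂ)) * σ ^ (2 * m - k))
      (fun s => hgen s σ) (Nat.lt_succ_of_le hk)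
  have h2 := coeff_eq_of_sum_pow_eq (n := 2 * m + 1)
    (a := fun l => ∫ η : ℂ, pairDensity m k l η)
    (b := fun l => if l = 2 * m - k then K * ((-1) ^ k * ((2 * m).choose k : ℂ)) else 0)
    (fun σ => by
      rw [h1 σ]
      simp [Finset.sum_ite_eq', mul_comm]) (Nat.lt_succ_of_le hl)
  rw [h2, hK]
  simp only [mul_assoc]

/-- The reproducing property, for the functions that span the eigenspace. -/
theorem integral_coeffMode_mul_zonal {m : ℕ} (p : Omega) {k : ℕ} (hk : k ≤ 2 * m) :
    Integrable (fun η : ℂ => coeffMode m k (rotDiag η) * zonal m p (rotDiag η) /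
      (((1 + ‖η‖ ^ 2) ^ 2 : ℝ) : ℂ)) ∧
    ∫ η : ℂ, coeffMode m k (rotDiag η) * zonal m p (rotDiag η) /
      (((1 + ‖η‖ ^ 2) ^ 2 : ℝ) : ℂ) = Real.pi * coeffMode m k p := by
  set b : ℕ → ℂ := fun j => (2 * m + 1) / (m.factorial : ℂ) ^ 2 * ((-1) ^ (m + j) *
    (j.factorial : ℂ) * ((2 * m - j).factorial : ℂ) * coeffMode m j p) with hb
  have hexp : (fun η : ℂ => coeffMode m k (rotDiag η) * zonal m p (rotDiag η) /
      (((1 + ‖η‖ ^ 2) ^ 2 : ℝ) : ℂ)) = fun η => ∑ j ∈ Finset.range (2 * m + 1),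
        b j * pairDensity m k (2 * m - j) η := by
    funext η
    rw [zonal_eq, Finset.mul_sum, Finset.mul_sum, Finset.sum_div]
    refine Finset.sum_congr rfl fun j _ => ?_
    rw [hb, pairDensity]
    ring
  have hint : ∀ j ∈ Finset.range (2 * m + 1),
      Integrable fun η => b j * pairDensity m k (2 * m - j) η := fun j _ =>
    (integrable_pairDensity hk (Nat.sub_le _ _)).const_mul _
  rw [hexp]
  refine ⟨integrable_finsetSum _ hint, ?_⟩
  rw [integral_finsetSum _ hint, Finset.sum_eq_single k]
  · rw [integral_const_mul, integral_pairDensity hk (Nat.sub_le _ _), if_pos rfl, hb]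
    simp only
    have hm : (m.factorial : ℂ) ≠ 0 := by exact_mod_cast m.factorial_ne_zero
    have h2m1 : (2 * m + 1 : ℂ) ≠ 0 := by exact_mod_cast (2 * m).succ_ne_zero
    have hch : ((2 * m).choose k : ℂ) * k.factorial * (2 * m - k).factorial =
        (2 * m).factorial := by
      exact_mod_cast Nat.choose_mul_factorial_mul_factorial hk
    have hf : ((2 * m + 1).factorial : ℂ) = (2 * m + 1) * (2 * m).factorial := by
      rw [Nat.factorial_succ]
      push_cast
      rfl
    rw [hf, ← hch, pow_add]
    have hs1 := neg_one_pow_mul_self m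
    have hs2 := neg_one_pow_mul_self k
    have hk1 : (k.factorial : ℂ) ≠ 0 := by exact_mod_cast k.factorial_ne_zero
    have hk2 : ((2 * m - k).factorial : ℂ) ≠ 0 := by exact_mod_cast (2 * m - k).factorial_ne_zero
    have hk3 : ((2 * m).choose k : ℂ) ≠ 0 := by exact_mod_cast (Nat.choose_pos hk).ne'
    field_simp
    linear_combination coeffMode m k p * ((((-1 : ℂ) ^ k) * (-1) ^ k) * hs1 + hs2)
  · intro j hj hjk
    have hj' := Nat.lt_succ_iff.1 (Finset.mem_range.1 hj)
    rw [integral_const_mul, integral_pairDensity hk (Nat.sub_le _ _), if_neg (by omega), mul_zero]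
  · exact fun h => absurd (Finset.mem_range.2 (Nat.lt_succ_of_le hk)) h

end ComplexZonal

theorem mainTheorem10 (m : ℕ) :
    (∀ p q : ComplexZonal.Omega, ComplexZonal.zonal m p q = ComplexZonal.zonal m q p) ∧
    (∀ p : ComplexZonal.Omega, ComplexZonal.zonal m p p = 2 * (m : ℂ) + 1) ∧
    (∀ p : ComplexZonal.Omega, ∀ f ∈ ComplexZonal.eigenspace (4 * (m : ℂ) * ((m : ℂ) + 1)),
      MeasureTheory.Integrable (fun η : ℂ =>
        f (ComplexZonal.rotDiag η) * ComplexZonal.zonal m p (ComplexZonal.rotDiag η) /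
          ((1 + ‖η‖ ^ 2) ^ 2 : ℝ)) MeasureTheory.volume ∧
      (1 / Real.pi : ℂ) * ∫ η : ℂ,
        f (ComplexZonal.rotDiag η) * ComplexZonal.zonal m p (ComplexZonal.rotDiag η) /
          ((1 + ‖η‖ ^ 2) ^ 2 : ℝ) = f p) := by
  refine ⟨ComplexZonal.zonal_symm m, ComplexZonal.zonal_self m, fun p f hf => ?_⟩
  obtain ⟨c, hc⟩ := ComplexZonal.exists_eq_sum_coeffMode hf
  have hexp : (fun η : ℂ =>
      f (ComplexZonal.rotDiag η) * ComplexZonal.zonal m p (ComplexZonal.rotDiag η) /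
        (((1 + ‖η‖ ^ 2) ^ 2 : ℝ) : ℂ)) = fun η => ∑ k ∈ Finset.range (2 * m + 1),
      c k * (ComplexZonal.coeffMode m k (ComplexZonal.rotDiag η) *
        ComplexZonal.zonal m p (ComplexZonal.rotDiag η) / (((1 + ‖η‖ ^ 2) ^ 2 : ℝ) : ℂ)) := by
    funext η
    rw [hc, Finset.sum_mul, Finset.sum_div]
    exact Finset.sum_congr rfl fun k _ => by ring
  have hk : ∀ k ∈ Finset.range (2 * m + 1), k ≤ 2 * m := fun k hk =>
    Nat.lt_succ_iff.1 (Finset.mem_range.1 hk)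
  have hint := fun k h =>
    (ComplexZonal.integral_coeffMode_mul_zonal (m := m) p (hk k h)).1.const_mul (c k)
  rw [hexp]
  refine ⟨MeasureTheory.integrable_finsetSum _ hint, ?_⟩
  rw [MeasureTheory.integral_finsetSum _ hint, hc p, Finset.mul_sum]
  refine Finset.sum_congr rfl fun k h => ?_
  rw [MeasureTheory.integral_const_mul, (ComplexZonal.integral_coeffMode_mul_zonal p (hk k h)).2]
  have hpi : (Real.pi : ℂ) ≠ 0 := by exact_mod_cast Real.pi_ne_zero
  field_simp
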